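/- Let $n\ge 1$, work over $\mathbb{C}$, write $[n]=\{1,\dots,n\}$, and read indices of $L_i$, $u_i$, $g_i$ cyclically modulo $n$. For $i\in[n]$ and $y\in\mathbb{A}^1$ let $g_i(y)$ be the diagonal $n\times n$ matrix with $i$-th entry $y$ and other diagonal entries $1$. The global Schubert variety is $$X=\{(y,L_1,\dots,L_n)\in\mathbb{A}^1\times(\mathbb{P}^{n-1})^n \mid g_i(y)L_i\subset L_{i+1}\ (i\in[n])\},\qquad f(y,L_1,\dots,L_n)=y,$$ with generic part $X_\eta=f^{-1}(\mathbb{A}^1\smallsetminus\{0\})$ and special fiber $f^{-1}(0)$. *Torus.* Let $T\subset \mathrm{PGL}_n(\mathbb{C})$ be the diagonal torus and $\hat T=T\times\mathbb{G}_m$. It acts on $X$ by $t\cdot(y,L_1,\dots,L_n)=(y,tL_1,\dots,tL_n)$ for $t\in T$ and $z\cdot(y,L_1,\dots,L_n)=(zy,L_1,g_1(z)L_2,\dots,g_1(z)\cdots g_{n-1}(z)L_n)$ for $z\in\mathbb{G}_m$. Let $\alpha_i(\mathrm{diag}(y_1,\dots,y_n),z)=y_{i+1}y_i^{-1}$ for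 $1\le i<n$ and $\alpha_n(\mathrm{diag}(y_1,\dots,y_n),z)=z\,y_1y_n^{-1}$; $\hat T$ acts on $\mathbb{A}^n$ by $t\cdot(x_1,\dots,x_n)=(\alpha_1(t)x_1,\dots,\alpha_n(t)x_n)$. *Strata of $\mathbb{A}^n$.* For $I\subset[n]$ let $(\mathbb{A}^n)_I=\{x\mid x_i=0\iff i\notin I\}$, and let $(\mathbb{A}^n)_\eta=\{x\mid x_1\cdots x_n\ne0\}$. *The map $u$.* For $j,k\in[n]$ let $p_{j,k}(x)=1$ if $k-j\in\{-1,n-1\}$; otherwise $p_{j,k}(x)=x_jx_{j+1}\cdots x_k$ if $j\le k$, and $p_{j,k}(x)=x_j\cdots x_n\,x_1\cdots x_k$ if $k<j$. Put $u_k=[p_{k,n}:p_{k,1}:\cdots:p_{k,n-1}]$ and $$u:\mathbb{A}^n\to X,\qquad u(x)=(x_1\cdots x_n,u_1(x),\dots,u_n(x)).$$ *Affine flag variety.* Let $B\subset\mathrm{PGL}_n(\mathbb{C}((t)))$ be the upper-triangular Iwahori subgroup (the image of the matrices in $\mathrm{GL}_n(\mathbb{C}[[t]])$ that are upper triangular modulo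 $t$) and $\mathrm{Fl}=\mathrm{PGL}_n(\mathbb{C}((t)))/B$. Let $W_{\mathrm{ext}}=S_n\ltimes(\mathbb{Z}^n/\mathbb{Z}(1,\dots,1))$, with translations $t_\lambda$, where $e_1,\dots,e_n$ is the standard basis of $\mathbb{Z}^n$; permutations are represented in $\mathrm{PGL}_n(\mathbb{C}((t)))$ by permutation matrices and $t_\lambda$ by $\mathrm{diag}(t^{-\lambda_1},\dots,t^{-\lambda_n})$, and $\mathrm{Fl}_w=BwB/B$. Let $s_i=(i\ \,i{+}1)$ for $i<n$, let $s_n=s_{\alpha_0}t_{-\alpha_0}$ with $\alpha_0=e_1-e_n$ and $s_{\alpha_0}=(1\ n)$, and let $\omega=s_1\cdots s_{n-1}t_{e_n}$. For $I\subsetneq[n]$, an acceptable order on $I$ is a listing $i_1,\dots,i_k$ of its elements without repetition such that (if $k\ge 1$) the cyclic successor of $i_1$ is not in $I$ and exactly one of the inequalities $i_1>i_2>\cdots>i_k>i_1$ fails. Put $w_I=s_{i_1}\cdots s_{i_k}\omega$ for such an order (it exists, and $w_I$ does not depend on it) and $\mathrm{Fl}_I=\mathrm{Fl}_{w_I}$.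 *Embedding of the special fiber.* For $0\le m<n$ let $\lambda_m\subset\mathbb{C}((t))^n$ be the $\mathbb{C}[[t]]$-lattice with basis $t^{-1}e_1,\dots,t^{-1}e_m,e_{m+1},\dots,e_n$, where now $e_1,\dots,e_n$ is the standard basis of $\mathbb{C}((t))^n$. The special fiber is embedded in $\mathrm{Fl}$ by sending $(0,L_1,\dots,L_n)$ to the class $gB$ of any $g$ such that, for $1\le i\le n$, $g\lambda_{i-1}$ is the preimage of $L_i$ under $\lambda_{i-1}\to\lambda_{i-1}/t\lambda_{i-1}\cong\mathbb{C}^n$. Via this embedding, $\mathrm{Fl}_I$ is regarded as a subset of $f^{-1}(0)$. **Lemma.** The map $u:\mathbb{A}^n\to X$ is a $\hat T$-equivariant open embedding of varieties. It satisfies $$u^{-1}(X_\eta)=(\mathbb{A}^n)_\eta\qquad\text{and}\qquad u^{-1}(\mathrm{Fl}_I)=(\mathbb{A}^n)_I\quad\text{for every } I\subsetneq[n],$$ and its image meets every $B$-orbit in $f^{-1}(0)$. -/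

import Mathlib

open scoped LinearAlgebra.Projectivization MatrixGroups

noncomputable section

namespace GlobalSchubert

/-! ### The global Schubert variety

Indices `1, …, n` are represented by `Fin n` (so `i` stands for `i + 1`), and `i + 1 : Fin n` is the
cyclic successor. -/

/-- The matrix `g_i(y)`: diagonal, with `y` as its `i`-th entry and `1` elsewhere. -/
def gMat (n : ℕ) (i : Fin n) (y : ℂ) : Matrix (Fin n) (Fin n) ℂ :=
  Matrix.diagonal (fun j => if j = i then y else 1)

/-- The global Schubert variety: tuples `(y, L_1, …, L_n)` in `𝔸¹ × ℙⁿ⁻¹ × ⋯ × ℙⁿ⁻¹` with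
`g_i(y) L_i ⊂ L_{i+1}` for all `i` (cyclically). -/
@[ext]
structure GrBar (n : ℕ) [NeZero n] where
  y : ℂ
  L : Fin n → ℙ ℂ (Fin n → ℂ)
  incl : ∀ i : Fin n, ∀ v ∈ (L i).submodule, (gMat n i y).mulVec v ∈ (L (i + 1)).submodule

/-- The structure map `f : GrBar → 𝔸¹`. -/
def GrBar.f {n : ℕ} [NeZero n] (q : GrBar n) : ℂ := q.y

/-- The generic part `f⁻¹(𝔸¹ ∖ {0})`. -/
def GrBar.generic (n : ℕ) [NeZero n] : Set (GrBar n) := {q | q.f ≠ 0}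

/-- The special fiber `f⁻¹(0)`. -/
def GrBar.special (n : ℕ) [NeZero n] : Set (GrBar n) := {q | q.f = 0}

/-- Affine space `𝔸ⁿ` over `ℂ`; it carries the Zariski topology, not the Euclidean one. -/
@[ext]
structure AffSpace (n : ℕ) where
  coord : Fin n → ℂ

/-- The stratum `(𝔸ⁿ)_I`: the points with `x_i = 0` if and only if `i ∉ I`. -/
def AffSpace.stratum {n : ℕ} (I : Finset (Fin n)) : Set (AffSpace n) :=
  {x | ∀ i, x.coord i = 0 ↔ i ∉ I}

/-- The generic part of `𝔸ⁿ` with respect to `(x_1, …, x_n) ↦ x_1 ⋯ x_n`. -/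
def AffSpace.generic (n : ℕ) : Set (AffSpace n) := {x | ∏ i, x.coord i ≠ 0}

/-! ### Zariski topologies, regular functions, open embeddings -/

/-- The Zariski topology of `𝔸ⁿ`. -/
instance (n : ℕ) : TopologicalSpace (AffSpace n) :=
  TopologicalSpace.generateFrom
    {U | ∃ F : MvPolynomial (Fin n) ℂ, U = {x : AffSpace n | MvPolynomial.eval x.coord F ≠ 0}}

/-- `φ` is regular on `V ⊂ 𝔸ⁿ`: locally on `V` it is a quotient of polynomials. -/
def AffSpace.IsRegularOn {n : ℕ} (V : Set (AffSpace n)) (φ : AffSpace n → ℂ) : Prop :=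
  ∀ x ∈ V, ∃ W : Set (AffSpace n), IsOpen W ∧ x ∈ W ∧ W ⊆ V ∧
    ∃ F G : MvPolynomial (Fin n) ℂ, ∀ x' ∈ W,
      MvPolynomial.eval x'.coord G ≠ 0 ∧ φ x' = MvPolynomial.eval x'.coord F / MvPolynomial.eval x'.coord G

/-- The multidegree of the variables on `𝔸¹ × (ℙⁿ⁻¹)ⁿ`: the coordinate `y` of `𝔸¹` (`none`) has degree
`0`, the `j`-th homogeneous coordinate on the `i`-th projective space (`some (i, j)`) has degree `1` in
the `i`-th component. -/
def multiWeight (n : ℕ) : Option (Fin n × Fin n) → (Fin n → ℕ)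
  | none => 0
  | some (i, _) => Pi.single i 1

/-- `F` is homogeneous of degree `d i` in the homogeneous coordinates of the `i`-th projective space,
for each `i`. -/
def IsMultihomogeneous {n : ℕ} (F : MvPolynomial (Option (Fin n × Fin n)) ℂ) (d : Fin n → ℕ) : Prop :=
  MvPolynomial.IsWeightedHomogeneous (multiWeight n) F d

/-- The value of a polynomial at `y` and at representing vectors of the lines `L_i`. For multihomogeneous
`F`, `G` of the same multidegree neither the vanishing of `F` nor the quotient of the values of `F` and `G`
depends on the representatives. -/
def GrBar.evalRep {n : ℕ} [NeZero n] (q : GrBar n) (F : MvPolynomial (Option (Fin n × Fin n)) ℂ) : ℂ :=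
  MvPolynomial.eval (fun s : Option (Fin n × Fin n) =>
    match s with
    | none => q.y
    | some (i, j) => (q.L i).rep j) F

/-- The Zariski topology of the global Schubert variety, induced from `𝔸¹ × (ℙⁿ⁻¹)ⁿ`. -/
instance (n : ℕ) [NeZero n] : TopologicalSpace (GrBar n) :=
  TopologicalSpace.generateFrom
    {U | ∃ (d : Fin n → ℕ) (F : MvPolynomial (Option (Fin n × Fin n)) ℂ),
      IsMultihomogeneous F d ∧ U = {q : GrBar n | q.evalRep F ≠ 0}}

/-- `φ` is regular on `V ⊂ GrBar`: locally on `V` it is a quotient of multihomogeneous polynomials of the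
same multidegree. -/
def GrBar.IsRegularOn {n : ℕ} [NeZero n] (V : Set (GrBar n)) (φ : GrBar n → ℂ) : Prop :=
  ∀ q ∈ V, ∃ W : Set (GrBar n), IsOpen W ∧ q ∈ W ∧ W ⊆ V ∧
    ∃ (d : Fin n → ℕ) (F G : MvPolynomial (Option (Fin n × Fin n)) ℂ),
      IsMultihomogeneous F d ∧ IsMultihomogeneous G d ∧
      ∀ q' ∈ W, q'.evalRep G ≠ 0 ∧ φ q' = q'.evalRep F / q'.evalRep G

/-- `u : X → Y` is an open embedding of varieties (viewed as spaces with a sheaf of regular functions): a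
homeomorphism onto an open subset under which regular functions on open sets correspond to each other. -/
def IsVarietyOpenEmbedding {X Y : Type} [TopologicalSpace X] [TopologicalSpace Y]
    (regX : Set X → (X → ℂ) → Prop) (regY : Set Y → (Y → ℂ) → Prop) (u : X → Y) : Prop :=
  Topology.IsOpenEmbedding u ∧
    ∀ V : Set X, IsOpen V → ∀ φ : Y → ℂ, regY (u '' V) φ ↔ regX V (φ ∘ u)

/-! ### The torus and its actions -/

/-- Invertible diagonal matrices. -/
def diagGL (n : ℕ) (F : Type) [Field F] : (Fin n → Fˣ) →* GL (Fin n) F where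
  toFun w :=
    ⟨Matrix.diagonal fun j => (w j : F), Matrix.diagonal fun j => ((w j)⁻¹ : Fˣ), by simp, by simp⟩
  map_one' := by ext; simp
  map_mul' a b := by
    ext i j
    rcases eq_or_ne i j with rfl | h
    · simp
    · simp [Matrix.diagonal_apply_ne _ h]

/-- The class in `PGL_n` of an invertible diagonal matrix. -/
def diagPGL (n : ℕ) (F : Type) [Field F] : (Fin n → Fˣ) →* PGL(n, F) :=
  Matrix.ProjGenLinGroup.mk.comp (diagGL n F)

/-- The maximal torus `T ⊂ PGL_n(ℂ)` of diagonal matrices. -/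
abbrev diagTorus (n : ℕ) : Subgroup PGL(n, ℂ) := (diagPGL n ℂ).range

/-- `T̂ = T × 𝔾_m`. -/
abbrev HatT (n : ℕ) : Type := diagTorus n × ℂˣ

/-- The character `diag(y_1, …, y_n) ↦ y_{i+1} y_i⁻¹` of `(ℂˣ)ⁿ` (cyclically: `y_1 y_n⁻¹` for `i = n`). -/
def ratioChar (n : ℕ) [NeZero n] (i : Fin n) : (Fin n → ℂˣ) →* ℂˣ where
  toFun w := w (i + 1) * (w i)⁻¹
  map_one' := by simp
  map_mul' a b := by
    simp only [Pi.mul_apply, mul_inv]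
    exact mul_mul_mul_comm _ _ _ _

theorem diagPGL_eq_one_iff {n : ℕ} {F : Type} [Field F] (w : Fin n → Fˣ) :
    diagPGL n F w = 1 ↔ ∃ c : Fˣ, w = fun _ => c := by
  unfold diagPGL diagGL
  rw [MonoidHom.comp_apply, Matrix.ProjGenLinGroup.mk_eq_one,
    Matrix.GeneralLinearGroup.center_eq_range_scalar]
  constructor
  · rintro ⟨c, hc⟩
    refine ⟨c, funext fun j => ?_⟩
    have := congrArg (fun g : GL (Fin n) F => g.1 j j) hc
    simp at this
    exact Units.ext this.symm
  · rintro ⟨c, rfl⟩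
    refine ⟨c, ?_⟩
    ext i j
    simp [Matrix.diagonal_apply]

/-- The character `diag(y_1, …, y_n) ↦ y_{i+1} y_i⁻¹` of `T` (cyclically). -/
def torusChar (n : ℕ) [NeZero n] (i : Fin n) : diagTorus n →* ℂˣ :=
  (QuotientGroup.lift (diagPGL n ℂ).ker (ratioChar n i) (by
    intro w hw
    obtain ⟨c, rfl⟩ := (diagPGL_eq_one_iff w).1 hw
    simp [ratioChar])).comp
    (QuotientGroup.quotientKerEquivRange (diagPGL n ℂ)).symm.toMonoidHom

/-- The characters `α_1, …, α_n` of `T̂`: `α_i(y, z) = y_{i+1} y_i⁻¹` for `i < n`, and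
`α_n(y, z) = z y_1 y_n⁻¹`. -/
def alpha (n : ℕ) [NeZero n] (i : Fin n) (t : HatT n) : ℂˣ :=
  (if (i : ℕ) = n - 1 then t.2 else 1) * torusChar n i t.1

theorem torusChar_diag {n : ℕ} [NeZero n] (i : Fin n) (w : Fin n → ℂˣ) :
    torusChar n i ⟨diagPGL n ℂ w, w, rfl⟩ = w (i + 1) * (w i)⁻¹ := by
  have h : (QuotientGroup.quotientKerEquivRange (diagPGL n ℂ)).symm ⟨diagPGL n ℂ w, w, rfl⟩
      = (w : (Fin n → ℂˣ) ⧸ (diagPGL n ℂ).ker) := by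
    rw [MulEquiv.symm_apply_eq]
    rfl
  unfold torusChar
  rw [MonoidHom.comp_apply, MulEquiv.toMonoidHom_eq_coe, MonoidHom.coe_coe, h]
  rfl

/-- The action of `T̂` on `𝔸ⁿ` with weights `α_1, …, α_n`. -/
instance (n : ℕ) [NeZero n] : MulAction (HatT n) (AffSpace n) where
  smul t x := ⟨fun i => (alpha n i t : ℂ) * x.coord i⟩
  one_smul x := by
    refine AffSpace.ext (funext fun i => ?_)
    change (alpha n i 1 : ℂ) * x.coord i = x.coord i
    simp [alpha]
  mul_smul s t x := by
    refine AffSpace.ext (funext fun i => ?_)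
    change (alpha n i (s * t) : ℂ) * x.coord i =
      (alpha n i s : ℂ) * ((alpha n i t : ℂ) * x.coord i)
    unfold alpha
    split_ifs <;> simp <;> ring

/-- The entries of the diagonal matrix `g_1(z) ⋯ g_{k-1}(z)` (`z` in the first `k - 1` places, then `1`),
where `k` is numbered from `1`. -/
def rotDiag (n : ℕ) (k : Fin n) (z : ℂˣ) : Fin n → ℂˣ := fun j => if j < k then z else 1

theorem diagPGL_smul_mem {n : ℕ} (w : Fin n → ℂˣ) (l : ℙ ℂ (Fin n → ℂ)) (v : Fin n → ℂ) :
    v ∈ (diagPGL n ℂ w • l).submodule ↔ (fun j => ((w j)⁻¹ : ℂ) * v j) ∈ l.submodule := by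
  induction l using Projectivization.ind with
  | h a ha =>
    unfold diagPGL
    rw [MonoidHom.comp_apply, Projectivization.PGL.mk_smul_mk, Projectivization.submodule_mk,
      Projectivization.submodule_mk, Submodule.mem_span_singleton, Submodule.mem_span_singleton]
    refine exists_congr fun c => ?_
    rw [funext_iff, funext_iff]
    refine forall_congr' fun j => ?_
    have h : (w j : ℂ) ≠ 0 := (w j).ne_zero
    have e : (diagGL n ℂ w • a) j = w j * a j := by
      change ((Matrix.diagonal fun j => (w j : ℂ)).mulVec a) j = _
      rw [Matrix.mulVec_diagonal]
    rw [Pi.smul_apply, e]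
    simp only [smul_eq_mul, Pi.smul_apply]
    constructor
    · rintro h1
      rw [← h1]
      field_simp
    · rintro h1
      rw [← mul_assoc, mul_comm c, mul_assoc, h1]
      field_simp

/-- The action of `T̂` on the global Schubert variety:
`t · (y, L_1, …, L_n) = (y, t L_1, …, t L_n)` for `t ∈ T`, and
`z · (y, L_1, …, L_n) = (z y, L_1, g_1(z) L_2, …, g_1(z) ⋯ g_{n-1}(z) L_n)` for `z ∈ 𝔾_m`. -/
instance (n : ℕ) [NeZero n] : MulAction (HatT n) (GrBar n) where
  smul t q :=
    { y := t.2 * q.y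
      L := fun k => (t.1 : PGL(n, ℂ)) • diagPGL n ℂ (rotDiag n k t.2) • q.L k
      incl := by
        obtain ⟨⟨_, w, rfl⟩, z⟩ := t
        intro i v hv
        simp only [diagPGL_smul_mem] at hv ⊢
        have h1 := q.incl i _ hv
        have hz : (z : ℂ) ≠ 0 := z.ne_zero
        have key : ∃ c : ℂ, (fun j => ((rotDiag n (i + 1) z j : ℂ))⁻¹ *
            (((w j : ℂ))⁻¹ * (gMat n i (z * q.y)).mulVec v j)) =
            c • (gMat n i q.y).mulVec
              (fun j => ((rotDiag n i z j : ℂ))⁻¹ * (((w j : ℂ))⁻¹ * v j)) := by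
          by_cases hi : (i : ℕ) + 1 = n
          · refine ⟨z, funext fun j => ?_⟩
            have hlt : ¬ j < i + 1 := by
              have : i + 1 = 0 := by
                apply Fin.ext
                rw [Fin.val_add, Fin.val_zero, Fin.val_one', Nat.add_mod_mod, hi, Nat.mod_self]
              rw [this]
              exact Fin.not_lt_zero j
            have hj : j = i ∨ j < i := by
              have := j.2
              rcases lt_trichotomy j i with h | h | h
              · exact Or.inr h
              · exact Or.inl h
              · have := Fin.lt_def.1 h
                omega
            simp only [gMat, Matrix.mulVec_diagonal, rotDiag, hlt, Pi.smul_apply, smul_eq_mul]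
            rcases hj with rfl | hj
            · simp
              ring
            · simp [hj, hj.ne]
          · refine ⟨1, funext fun j => ?_⟩
            have hv : ((i + 1 : Fin n) : ℕ) = i + 1 := by
              have := i.2
              rw [Fin.val_add, Fin.val_one', Nat.add_mod_mod, Nat.mod_eq_of_lt]
              omega
            simp only [gMat, Matrix.mulVec_diagonal, rotDiag, Pi.smul_apply, smul_eq_mul,
              Fin.lt_def, hv, Fin.ext_iff]
            rcases lt_trichotomy (j : ℕ) (i : ℕ) with h | h | h
            · have h2 : (j : ℕ) < i + 1 := by omega
              simp [h, h2, h.ne]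
            · simp [h]
              field_simp
            · have h2 : ¬ (j : ℕ) < i + 1 := by omega
              have h3 : ¬ (j : ℕ) < i := by omega
              simp [h2, h3, h.ne']
        obtain ⟨c, hc⟩ := key
        rw [hc]
        exact Submodule.smul_mem _ c h1 }
  one_smul q := by
    refine GrBar.ext ?_ (funext fun k => ?_)
    · change ((1 : ℂˣ) : ℂ) * q.y = q.y
      simp
    · change (1 : PGL(n, ℂ)) • diagPGL n ℂ (rotDiag n k 1) • q.L k = q.L k
      have : rotDiag n k 1 = 1 := by
        funext j
        simp [rotDiag]
      rw [this, map_one, one_smul, one_smul]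
  mul_smul s t q := by
    obtain ⟨⟨_, a, rfl⟩, z⟩ := s
    obtain ⟨⟨_, b, rfl⟩, z'⟩ := t
    refine GrBar.ext ?_ (funext fun k => ?_)
    · change ((z * z' : ℂˣ) : ℂ) * q.y = z * (z' * q.y)
      rw [Units.val_mul, mul_assoc]
    · change (diagPGL n ℂ a * diagPGL n ℂ b) • diagPGL n ℂ (rotDiag n k (z * z')) • q.L k =
        diagPGL n ℂ a • diagPGL n ℂ (rotDiag n k z) • diagPGL n ℂ b •
          diagPGL n ℂ (rotDiag n k z') • q.L k
      have : rotDiag n k (z * z') = rotDiag n k z * rotDiag n k z' := by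
        funext j
        simp only [rotDiag, Pi.mul_apply]
        split_ifs <;> simp
      simp only [smul_smul, ← map_mul, this]
      congr 2
      rw [mul_assoc, mul_left_comm b]

/-! ### The chart `u` -/

/-- The function `p_{j,k}`: the product of the variables from `x_j` cyclically up to `x_k`, except that it
is `1` when this would be the product of all variables. -/
def pFun {n : ℕ} (j k : Fin n) (x : Fin n → ℂ) : ℂ :=
  if (k : ℤ) - j = -1 ∨ (k : ℤ) - j = n - 1 then 1
  else if j ≤ k then ∏ i ∈ Finset.Icc j k, x i
  else (∏ i ∈ Finset.Ici j, x i) * ∏ i ∈ Finset.Iic k, x i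

/-- Homogeneous coordinates of `u_k = [p_{k,n} : p_{k,1} : ⋯ : p_{k,n-1}]`. -/
def uVec {n : ℕ} [NeZero n] (k : Fin n) (x : Fin n → ℂ) : Fin n → ℂ := fun j => pFun k (j - 1) x

theorem fin_val_sub_one {n : ℕ} [NeZero n] (j : Fin n) :
    ((j - 1 : Fin n) : ℤ) = if (j : ℕ) = 0 then (n : ℤ) - 1 else (j : ℤ) - 1 := by
  have h1 := (j - 1).2
  have h2 : ((j - 1 + 1 : Fin n) : ℕ) = ((j - 1 : Fin n) + 1) % n := by
    rw [Fin.val_add, Fin.val_one', Nat.add_mod_mod]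
  rw [sub_add_cancel] at h2
  rcases Nat.lt_or_ge ((j - 1 : Fin n) + 1) n with h | h
  · rw [Nat.mod_eq_of_lt h] at h2
    rw [if_neg (by omega)]
    omega
  · have h3 : ((j - 1 : Fin n) : ℕ) + 1 = n := by omega
    rw [h3, Nat.mod_self] at h2
    rw [if_pos h2]
    omega

theorem fin_val_succ {n : ℕ} [NeZero n] (j : Fin n) :
    ((j + 1 : Fin n) : ℤ) = if (j : ℕ) + 1 = n then 0 else (j : ℤ) + 1 := by
  rw [Fin.val_add, Fin.val_one', Nat.add_mod_mod]
  split_ifs with h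
  · rw [h, Nat.mod_self]; rfl
  · rw [Nat.mod_eq_of_lt (by have := j.2; omega)]; push_cast; rfl

theorem uVec_self {n : ℕ} [NeZero n] (k : Fin n) (x : Fin n → ℂ) : uVec k x k = 1 := by
  unfold uVec pFun
  rw [if_pos]
  rw [fin_val_sub_one]
  split_ifs with h
  · right; rw [h]; simp
  · left; ring

theorem uVec_ne_zero {n : ℕ} [NeZero n] (k : Fin n) (x : Fin n → ℂ) : uVec k x ≠ 0 := by
  intro h
  have := congrFun h k
  rw [uVec_self] at this
  exact one_ne_zero this

theorem pFun_eq {n : ℕ} (j k : Fin n) (x : Fin n → ℂ) :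
    pFun j k x = if (k : ℤ) - j = -1 ∨ (k : ℤ) - j = n - 1 then 1 else
      ∏ i ∈ Finset.univ.filter (fun i : Fin n => ((j : ℤ) ≤ k ∧ (j : ℤ) ≤ i ∧ (i : ℤ) ≤ k) ∨
        ((k : ℤ) < j ∧ ((j : ℤ) ≤ i ∨ (i : ℤ) ≤ k))), x i := by
  unfold pFun
  split_ifs with h1 h2
  · rfl
  · refine Finset.prod_congr ?_ fun _ _ => rfl
    ext i
    simp only [Finset.mem_Icc, Finset.mem_filter, Finset.mem_univ, true_and, Fin.le_def] at h2 ⊢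
    omega
  · rw [← Finset.prod_union]
    · refine Finset.prod_congr ?_ fun _ _ => rfl
      ext i
      simp only [Finset.mem_union, Finset.mem_Ici, Finset.mem_Iic, Finset.mem_filter,
        Finset.mem_univ, true_and, Fin.le_def] at h2 ⊢
      omega
    · rw [Finset.disjoint_left]
      intro i
      simp only [Finset.mem_Ici, Finset.mem_Iic, Fin.le_def] at h2 ⊢
      omega

theorem uVec_succ {n : ℕ} [NeZero n] (k j : Fin n) (x : Fin n → ℂ) :
    (if j = k then ∏ i, x i else 1) * uVec k x j = x k * uVec (k + 1) x j := by
  have hj := j.2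
  have hk := k.2
  by_cases hn : n = 1
  · subst hn
    have e1 : j = k := Subsingleton.elim _ _
    have e2 : k + 1 = k := Subsingleton.elim _ _
    subst e1
    rw [e2, uVec_self, if_pos rfl, Fin.prod_univ_one, Subsingleton.elim j 0]
  have hs := fin_val_succ k
  have hp := fin_val_sub_one j
  by_cases hjk : j = k
  · subst hjk
    rw [uVec_self, if_pos rfl, mul_one, uVec, pFun_eq, if_neg (by split_ifs at hs hp <;> omega),
      ← Finset.mul_prod_erase Finset.univ x (Finset.mem_univ j)]
    congr 1
    refine Finset.prod_congr ?_ fun _ _ => rfl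
    ext i
    have := i.2
    simp only [Finset.mem_erase, Finset.mem_filter, Finset.mem_univ, true_and, and_true, ne_eq,
      Fin.ext_iff]
    split_ifs at hs hp <;> omega
  · have hjk' : (j : ℕ) ≠ k := fun h => hjk (Fin.ext h)
    rw [if_neg hjk, one_mul]
    by_cases hj1 : j = k + 1
    · subst hj1
      rw [uVec_self, mul_one, uVec, add_sub_cancel_right, pFun_eq, if_neg (by omega),
        show x k = ∏ i ∈ {k}, x i by simp]
      refine Finset.prod_congr ?_ fun _ _ => rfl
      ext i
      simp only [Finset.mem_singleton, Finset.mem_filter, Finset.mem_univ, true_and, Fin.ext_iff]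
      omega
    · have hj1' : (j : ℕ) ≠ (k + 1 : Fin n) := fun h => hj1 (Fin.ext h)
      rw [uVec, uVec, pFun_eq, pFun_eq, if_neg (by split_ifs at hs hp <;> omega),
        if_neg (by split_ifs at hs hp <;> omega)]
      rw [← Finset.prod_insert (a := k)]
      · refine Finset.prod_congr ?_ fun _ _ => rfl
        ext i
        have := i.2
        simp only [Finset.mem_insert, Finset.mem_filter, Finset.mem_univ, true_and, Fin.ext_iff]
        split_ifs at hs hp <;> omega
      · simp only [Finset.mem_filter, Finset.mem_univ, true_and]
        split_ifs at hs hp <;> omega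

/-- The map `u : 𝔸ⁿ → GrBar`, `u(x) = (x_1 ⋯ x_n, u_1, …, u_n)`. -/
def chart (n : ℕ) [NeZero n] (x : AffSpace n) : GrBar n where
  y := ∏ i, x.coord i
  L k := Projectivization.mk ℂ (uVec k x.coord) (uVec_ne_zero k x.coord)
  incl i v hv := by
    rw [Projectivization.submodule_mk, Submodule.mem_span_singleton] at hv ⊢
    obtain ⟨c, rfl⟩ := hv
    refine ⟨c * x.coord i, funext fun j => ?_⟩
    have := uVec_succ i j x.coord
    simp only [gMat, Matrix.mulVec_diagonal, Pi.smul_apply, smul_eq_mul]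
    rw [mul_assoc, ← this]
    ring

/-! ### The extended affine Weyl group -/

/-- The coweight lattice `Y = ℤⁿ / ℤ (1, …, 1)` of `PGL_n`. -/
abbrev Coweight (n : ℕ) : Type :=
  (Fin n → ℤ) ⧸ AddSubgroup.zmultiples (fun _ : Fin n => (1 : ℤ))

/-- The class `e_i` of the `i`-th standard basis vector. -/
def basisCoweight {n : ℕ} (i : Fin n) : Coweight n :=
  QuotientAddGroup.mk (Pi.single i 1)

/-- The action of the symmetric group on `Y`, with `σ e_i = e_{σ i}`. -/
def permCoweight {n : ℕ} (σ : Equiv.Perm (Fin n)) : Coweight n ≃+ Coweight n :=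
  QuotientAddGroup.congr _ _
    { toFun := fun v => v ∘ σ.symm
      invFun := fun v => v ∘ σ
      left_inv := fun v => by ext; simp
      right_inv := fun v => by ext; simp
      map_add' := fun _ _ => rfl } (by
    rw [AddMonoidHom.map_zmultiples]
    rfl)

/-- The action of the symmetric group on `Y`, written multiplicatively. -/
def weylAction (n : ℕ) : Equiv.Perm (Fin n) →* MulAut (Multiplicative (Coweight n)) where
  toFun σ := AddEquiv.toMultiplicative (permCoweight σ)
  map_one' := by
    ext v
    induction v using QuotientAddGroup.induction_on
    rfl
  map_mul' σ τ := by
    ext v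
    induction v using QuotientAddGroup.induction_on
    rfl

/-- The extended affine Weyl group `W_ext = W ⋉ Y`. -/
abbrev WExt (n : ℕ) : Type := Multiplicative (Coweight n) ⋊[weylAction n] Equiv.Perm (Fin n)

/-- The translation `t_λ ∈ W_ext`. -/
def transl {n : ℕ} (c : Coweight n) : WExt n := SemidirectProduct.inl (Multiplicative.ofAdd c)

/-- The simple reflections: `s_i` exchanges `i` and `i + 1` for `i < n`, and `s_n = s_{α₀} t_{-α₀}`, where
`α₀ = e_1 - e_n` and `s_{α₀}` exchanges `1` and `n`. -/
def simpleRefl {n : ℕ} [NeZero n] (i : Fin n) : WExt n :=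
  if (i : ℕ) = n - 1 then
    SemidirectProduct.inr (Equiv.swap 0 i) * transl (-(basisCoweight 0 - basisCoweight i))
  else SemidirectProduct.inr (Equiv.swap i (i + 1))

/-- The product `s_{i_1} ⋯ s_{i_k}`. -/
def wordProd {n : ℕ} [NeZero n] (l : List (Fin n)) : WExt n := (l.map simpleRefl).prod

/-- The length-zero element `ω = s_1 s_2 ⋯ s_{n-1} t_{e_n}`. -/
def omega (n : ℕ) [NeZero n] : WExt n :=
  wordProd (List.finRange n).dropLast * transl (basisCoweight (-1))

/-- The list `l = (i_1, …, i_k)` is an acceptable order on `I`: it lists the elements of `I`, the cyclic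
successor of `i_1` is not in `I`, and exactly one of the inequalities `i_1 > i_2 > ⋯ > i_k > i_1` fails.
(The last two conditions are void for `I = ∅`.) -/
def IsAcceptableOrder {n : ℕ} [NeZero n] (I : Finset (Fin n)) (l : List (Fin n)) : Prop :=
  l.Nodup ∧ (∀ i, i ∈ l ↔ i ∈ I) ∧ (∀ i ∈ l.head?, i + 1 ∉ I) ∧
    (l ≠ [] → ∃! m : Fin l.length, ¬ l[m] >
      l[((m : ℕ) + 1) % l.length]'(Nat.mod_lt _ (lt_of_le_of_lt (Nat.zero_le _) m.2)))

theorem exists_isAcceptableOrder {n : ℕ} [NeZero n] (I : Finset (Fin n)) (hI : I ≠ Finset.univ) :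
    ∃ l, IsAcceptableOrder I l := by
  obtain ⟨j, hj⟩ : ∃ j, j ∉ I := by
    by_contra! h
    exact hI (Finset.eq_univ_iff_forall.2 h)
  have hdec : ∀ P : Fin n → Bool, ((List.finRange n).reverse.filter P).Pairwise (· > ·) :=
    fun P => (List.pairwise_reverse.2 (List.pairwise_lt_finRange n)).filter _
  obtain ⟨A, hA, hAm⟩ : ∃ A : List (Fin n), A.Pairwise (· > ·) ∧ ∀ i, i ∈ A ↔ i ∈ I ∧ i < j :=
    ⟨_, hdec (fun i => decide (i ∈ I ∧ i < j)), fun i => by simp⟩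
  obtain ⟨C, hC, hCm⟩ : ∃ C : List (Fin n), C.Pairwise (· > ·) ∧ ∀ i, i ∈ C ↔ i ∈ I ∧ j < i :=
    ⟨_, hdec (fun i => decide (i ∈ I ∧ j < i)), fun i => by simp⟩
  refine ⟨A ++ C, ?_, ?_, ?_, ?_⟩
  · rw [List.nodup_append]
    refine ⟨hA.imp fun h => h.ne', hC.imp fun h => h.ne', fun a ha b hb => ?_⟩
    exact (((hAm a).1 ha).2.trans ((hCm b).1 hb).2).ne
  · intro i
    rw [List.mem_append, hAm, hCm]
    constructor
    · rintro (h | h) <;> exact h.1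
    · intro h
      rcases lt_trichotomy i j with h1 | h1 | h1
      · exact Or.inl ⟨h, h1⟩
      · exact absurd (h1 ▸ h) hj
      · exact Or.inr ⟨h, h1⟩
  · intro i hi hi1
    have hs := fin_val_succ i
    have hiI := i.2
    have hi1j : (i + 1 : Fin n) ≠ j := fun h => hj (h ▸ hi1)
    have hi1j' : ((i + 1 : Fin n) : ℕ) ≠ j := fun h => hi1j (Fin.ext h)
    cases A with
    | cons a A =>
      simp only [List.cons_append, List.head?_cons, Option.mem_def, Option.some.injEq] at hi
      subst hi
      have h1 := ((hAm a).1 (by simp)).2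
      have h2 : (a + 1 : Fin n) ∈ a :: A := by
        refine (hAm _).2 ⟨hi1, ?_⟩
        rw [Fin.lt_def] at h1 ⊢
        have := j.2
        split_ifs at hs <;> omega
      have h3 : (a + 1 : Fin n) ≤ a := by
        rcases List.mem_cons.1 h2 with h | h
        · exact h.le
        · exact ((List.pairwise_cons.1 hA).1 _ h).le
      rw [Fin.le_def] at h3
      rw [Fin.lt_def] at h1
      have := j.2
      split_ifs at hs <;> omega
    | nil =>
      cases C with
      | nil => simp at hi
      | cons c C =>
        simp only [List.nil_append, List.head?_cons, Option.mem_def, Option.some.injEq] at hi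
        subst hi
        have h1 := ((hCm c).1 (by simp)).2
        have h0 : ¬ (c + 1 : Fin n) < j := fun h => by
          have := (hAm _).2 ⟨hi1, h⟩
          simp at this
        have h2 : (c + 1 : Fin n) ∈ c :: C := by
          refine (hCm _).2 ⟨hi1, ?_⟩
          exact lt_of_le_of_ne (not_lt.1 h0) hi1j.symm
        have h3 : (c + 1 : Fin n) ≤ c := by
          rcases List.mem_cons.1 h2 with h | h
          · exact h.le
          · exact ((List.pairwise_cons.1 hC).1 _ h).le
        rw [Fin.le_def] at h3
        rw [Fin.lt_def] at h1 h0
        split_ifs at hs <;> omega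
  · intro hne
    have hk : 0 < (A ++ C).length := List.length_pos_iff.2 hne
    have hlen : (A ++ C).length = A.length + C.length := List.length_append
    have h1 : ∀ x y (hx : x < (A ++ C).length) (hy : y < (A ++ C).length), x < y → y < A.length →
        (A ++ C)[y] < (A ++ C)[x] := by
      intro x y hx hy hxy hyA
      rw [List.getElem_append_left hyA, List.getElem_append_left (hxy.trans hyA)]
      exact List.pairwise_iff_getElem.1 hA _ _ _ _ hxy
    have h2 : ∀ x y (hx : x < (A ++ C).length) (hy : y < (A ++ C).length), x < y → A.length ≤ x →
        (A ++ C)[y] < (A ++ C)[x] := by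
      intro x y hx hy hxy hxA
      rw [List.getElem_append_right hxA, List.getElem_append_right (hxA.trans hxy.le)]
      exact List.pairwise_iff_getElem.1 hC _ _ _ _ (by omega)
    have h3 : ∀ x (hx : x < (A ++ C).length), x < A.length → (A ++ C)[x] < j := by
      intro x hx hxA
      rw [List.getElem_append_left hxA]
      exact ((hAm _).1 (List.getElem_mem _)).2
    have h4 : ∀ x (hx : x < (A ++ C).length), A.length ≤ x → j < (A ++ C)[x] := by
      intro x hx hxA
      rw [List.getElem_append_right hxA]
      exact ((hCm _).1 (List.getElem_mem _)).2
    generalize A ++ C = l at *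
    generalize A.length = p at *
    have key : ∀ m (hm : m < l.length),
        (¬ l[m] > l[(m + 1) % l.length]'(Nat.mod_lt _ hk)) ↔
          m = if p = 0 ∨ p = l.length then l.length - 1 else p - 1 := by
      intro m hm
      rcases Nat.lt_or_ge (m + 1) l.length with h | h
      · have e : (m + 1) % l.length = m + 1 := Nat.mod_eq_of_lt h
        simp only [e]
        rcases Nat.lt_trichotomy (m + 1) p with h' | h' | h'
        · have := h1 m (m + 1) hm h (by omega) h'
          simp only [gt_iff_lt, this, not_true_eq_false, false_iff]
          split_ifs <;> omega
        · have := (h3 m hm (by omega)).trans (h4 (m + 1) h (by omega))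
          simp only [gt_iff_lt, not_lt, this.le, true_iff]
          split_ifs <;> omega
        · have := h2 m (m + 1) hm h (by omega) (by omega)
          simp only [gt_iff_lt, this, not_true_eq_false, false_iff]
          split_ifs <;> omega
      · have hm' : m + 1 = l.length := by omega
        have e : (m + 1) % l.length = 0 := by rw [hm', Nat.mod_self]
        simp only [e]
        by_cases hp : p = 0 ∨ p = l.length
        · have : l[m] ≤ l[0] := by
            rcases Nat.eq_zero_or_pos m with h0 | h0
            · simp [h0]
            · rcases hp with hp | hp
              · exact (h2 0 m hk hm h0 (by omega)).le
              · exact (h1 0 m hk hm h0 (by omega)).le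
          rw [if_pos hp]
          simp only [gt_iff_lt, not_lt, this, true_iff]
          omega
        · have := (h3 0 hk (by omega)).trans (h4 m hm (by omega))
          rw [if_neg hp]
          simp only [gt_iff_lt, this, not_true_eq_false, false_iff]
          omega
    refine ⟨⟨if p = 0 ∨ p = l.length then l.length - 1 else p - 1, ?_⟩, ?_, ?_⟩
    · split_ifs <;> omega
    · exact (key _ _).2 rfl
    · intro m hm
      exact Fin.ext ((key m m.2).1 hm)

/-- The element `w_I = s_{i_1} ⋯ s_{i_k} ω`, for an acceptable order `i_1, …, i_k` on `I ⊊ {1, …, n}`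
(it does not depend on the choice of this order). -/
def wElt {n : ℕ} [NeZero n] (I : Finset (Fin n)) (hI : I ≠ Finset.univ) : WExt n :=
  wordProd (exists_isAcceptableOrder I hI).choose * omega n

/-! ### The affine flag variety -/

/-- The permutation matrix with `σ e_j = e_{σ j}`. -/
def permGL (n : ℕ) (F : Type) [Field F] : Equiv.Perm (Fin n) →* GL (Fin n) F where
  toFun σ :=
    ⟨Matrix.of fun i j => if i = σ j then 1 else 0,
      Matrix.of fun i j => if i = σ.symm j then 1 else 0, by
        ext i j
        simp [Matrix.mul_apply, Matrix.one_apply], by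
        ext i j
        simp [Matrix.mul_apply, Matrix.one_apply]⟩
  map_one' := by
    ext i j
    simp only [Matrix.of_apply, Equiv.Perm.one_apply, Units.val_one, Matrix.one_apply]
    congr
  map_mul' σ τ := by
    ext i j
    simp only [Matrix.of_apply, Equiv.Perm.mul_apply, Units.val_mul, Matrix.mul_apply, mul_ite,
      mul_one, mul_zero, Finset.sum_ite_eq', Finset.mem_univ, if_true]
    congr

/-- The class in `PGL_n` of a permutation matrix. -/
def permPGL (n : ℕ) (F : Type) [Field F] : Equiv.Perm (Fin n) →* PGL(n, F) :=
  Matrix.ProjGenLinGroup.mk.comp (permGL n F)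

theorem permPGL_conj {n : ℕ} {F : Type} [Field F] (σ : Equiv.Perm (Fin n)) (w : Fin n → Fˣ) :
    permPGL n F σ * diagPGL n F w * (permPGL n F σ)⁻¹ = diagPGL n F (w ∘ σ.symm) := by
  rw [mul_inv_eq_iff_eq_mul]
  unfold permPGL diagPGL
  simp only [MonoidHom.comp_apply, ← map_mul]
  congr 1
  ext i j
  simp only [Units.val_mul]
  change ((Matrix.of fun i j => if i = σ j then (1 : F) else 0) *
      Matrix.diagonal fun j => (w j : F)) i j =
    ((Matrix.diagonal fun j => ((w ∘ σ.symm) j : F)) *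
      (Matrix.of fun i j => if i = σ j then (1 : F) else 0)) i j
  rw [Matrix.mul_diagonal, Matrix.diagonal_mul]
  simp only [Matrix.of_apply, Function.comp_apply]
  split_ifs with h
  · rw [h, Equiv.symm_apply_apply]; ring
  · ring

/-- The indeterminate `t` as a unit of `ℂ((t))`. -/
def tUnit : (LaurentSeries ℂ)ˣ :=
  ⟨HahnSeries.single 1 1, HahnSeries.single (-1) 1, by simp, by simp⟩

/-- The representative `diag(t^{-λ_1}, …, t^{-λ_n}) ∈ PGL_n(ℂ((t)))` of the translation `t_λ`. -/
def translRep (n : ℕ) : Multiplicative (Coweight n) →* PGL(n, LaurentSeries ℂ) :=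
  AddMonoidHom.toMultiplicativeLeft (QuotientAddGroup.lift _
    (MonoidHom.toAdditiveRight ((diagPGL n (LaurentSeries ℂ)).comp
      { toFun := fun v => fun j => tUnit ^ (-(Multiplicative.toAdd v j))
        map_one' := by ext; simp
        map_mul' := fun a b => by ext; simp [mul_comm, zpow_add] })) (by
    intro v hv
    obtain ⟨k, rfl⟩ := AddSubgroup.mem_zmultiples_iff.1 hv
    rw [AddMonoidHom.mem_ker]
    change Additive.ofMul (diagPGL n (LaurentSeries ℂ) _) = 0
    rw [ofMul_eq_zero, diagPGL_eq_one_iff]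
    refine ⟨tUnit ^ (-k), funext fun j => ?_⟩
    change tUnit ^ (-((k • fun _ : Fin n => (1 : ℤ)) j)) = tUnit ^ (-k)
    simp))

/-- The standard representatives in `PGL_n(ℂ((t)))` of the elements of `W_ext`: a permutation is
represented by its permutation matrix, and `t_λ` by `diag(t^{-λ_1}, …, t^{-λ_n})`. With this sign
`s_n` is the simple affine reflection for the upper-triangular Iwahori subgroup. -/
def wRep (n : ℕ) : WExt n →* PGL(n, LaurentSeries ℂ) :=
  SemidirectProduct.lift (translRep n) (permPGL n (LaurentSeries ℂ)) (by
    intro σ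
    ext v
    exact (permPGL_conj σ (fun j => tUnit ^ (-(v j)))).symm)

/-- Upper triangular invertible complex matrices. -/
def upperTriangular (n : ℕ) : Subgroup (GL (Fin n) ℂ) where
  carrier := {g | Matrix.BlockTriangular g.1 id}
  mul_mem' ha hb := Matrix.BlockTriangular.mul ha hb
  one_mem' := Matrix.blockTriangular_one
  inv_mem' {g} hg := by
    have : Invertible g.1 := g.invertible
    change Matrix.BlockTriangular (g⁻¹).1 id
    rw [Matrix.coe_units_inv]
    exact Matrix.blockTriangular_inv_of_blockTriangular hg

/-- The upper-triangular Iwahori subgroup `B ⊂ PGL_n(ℂ((t)))`: the image of the group of matrices in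
`GL_n(ℂ[[t]])` that are upper triangular modulo `t`. -/
def iwahori (n : ℕ) : Subgroup PGL(n, LaurentSeries ℂ) :=
  ((upperTriangular n).comap
      (Matrix.GeneralLinearGroup.map (PowerSeries.constantCoeff (R := ℂ)))).map
    (Matrix.ProjGenLinGroup.mk.comp
      (Matrix.GeneralLinearGroup.map (algebraMap (PowerSeries ℂ) (LaurentSeries ℂ))))

/-- The affine flag variety `Fl = PGL_n(ℂ((t))) / B` (its set of points). -/
abbrev Fl (n : ℕ) : Type := PGL(n, LaurentSeries ℂ) ⧸ iwahori n

/-- The `B`-orbit `Fl_w = B w B / B`. -/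
def flOrbit {n : ℕ} (w : WExt n) : Set (Fl n) :=
  MulAction.orbit (iwahori n) (QuotientGroup.mk (wRep n w) : Fl n)

/-! ### The embedding of the special fiber in the affine flag variety -/

/-- The map `ℂ[[t]]ⁿ → ℂ((t))ⁿ`, `c ↦ ∑_j c_j b_j`, for the basis
`b = (t⁻¹ e_1, …, t⁻¹ e_m, e_{m+1}, …, e_n)`. -/
def latticeCoord (n m : ℕ) :
    (Fin n → PowerSeries ℂ) →ₗ[PowerSeries ℂ] (Fin n → LaurentSeries ℂ) :=
  LinearMap.pi fun j =>
    ((if (j : ℕ) < m then (((tUnit)⁻¹ : (LaurentSeries ℂ)ˣ) : LaurentSeries ℂ) else 1) •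
      Algebra.linearMap (PowerSeries ℂ) (LaurentSeries ℂ)).comp (LinearMap.proj j)

/-- The standard lattice `λ_m`, the `ℂ[[t]]`-span of `t⁻¹ e_1, …, t⁻¹ e_m, e_{m+1}, …, e_n`. The common
stabilizer in `GL_n(ℂ((t)))` of `λ_0, …, λ_{n-1}` is the upper-triangular Iwahori subgroup. -/
def stdLattice (n m : ℕ) : Submodule (PowerSeries ℂ) (Fin n → LaurentSeries ℂ) :=
  LinearMap.range (latticeCoord n m)

/-- The vectors in `ℂ[[t]]ⁿ` whose reduction modulo `t` lies in the line `l`. -/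
def reducesTo {n : ℕ} (l : ℙ ℂ (Fin n → ℂ)) : Submodule (PowerSeries ℂ) (Fin n → PowerSeries ℂ) where
  carrier := {c | (fun j => PowerSeries.constantCoeff (c j)) ∈ l.submodule}
  zero_mem' := by
    change (fun j => PowerSeries.constantCoeff ((0 : Fin n → PowerSeries ℂ) j)) ∈ l.submodule
    simpa [Pi.zero_def] using l.submodule.zero_mem
  add_mem' {a b} ha hb := by
    have := l.submodule.add_mem ha hb
    simpa [Pi.add_def] using this
  smul_mem' r a ha := by
    have := l.submodule.smul_mem (PowerSeries.constantCoeff r) ha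
    simpa [Pi.smul_def] using this

/-- The lattice `t λ_m ⊂ Λ ⊂ λ_m` that is the preimage of the line `l` under `λ_m → λ_m / t λ_m ≅ ℂⁿ`. -/
def lineLattice {n : ℕ} (m : ℕ) (l : ℙ ℂ (Fin n → ℂ)) :
    Submodule (PowerSeries ℂ) (Fin n → LaurentSeries ℂ) :=
  (reducesTo l).map (latticeCoord n m)

/-- The image of a lattice under a matrix. -/
def translateLattice {n : ℕ} (g : GL (Fin n) (LaurentSeries ℂ))
    (M : Submodule (PowerSeries ℂ) (Fin n → LaurentSeries ℂ)) :
    Submodule (PowerSeries ℂ) (Fin n → LaurentSeries ℂ) :=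
  M.map ((Matrix.toLin' g.1).restrictScalars (PowerSeries ℂ))

/-- The matrix `g_i(t)` acting on `ℂ[[t]]ⁿ`. -/
def gSeries {n : ℕ} (i : Fin n) : (Fin n → PowerSeries ℂ) →ₗ[PowerSeries ℂ] (Fin n → PowerSeries ℂ) :=
  LinearMap.pi fun j => (if j = i then (PowerSeries.X : PowerSeries ℂ) else 1) • LinearMap.proj j

theorem gSeries_apply {n : ℕ} (i j : Fin n) (c : Fin n → PowerSeries ℂ) :
    gSeries i c j = if j = i then PowerSeries.X * c j else c j := by
  simp only [gSeries, LinearMap.pi_apply, LinearMap.smul_apply, LinearMap.proj_apply, smul_eq_mul]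
  split_ifs <;> simp

theorem mem_reducesTo {n : ℕ} {l : ℙ ℂ (Fin n → ℂ)} {c : Fin n → PowerSeries ℂ} :
    c ∈ reducesTo l ↔ (fun j => PowerSeries.constantCoeff (c j)) ∈ l.submodule := Iff.rfl

theorem exists_eq_X_smul {n : ℕ} (c : Fin n → PowerSeries ℂ)
    (hc : ∀ j, PowerSeries.constantCoeff (c j) = 0) :
    ∃ d : Fin n → PowerSeries ℂ, ∀ j, c j = PowerSeries.X * d j := by
  choose d hd using fun j => PowerSeries.X_dvd_iff.2 (hc j)
  exact ⟨d, hd⟩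

theorem rep_mem_submodule {n : ℕ} (l : ℙ ℂ (Fin n → ℂ)) : l.rep ∈ l.submodule := by
  have : l.rep ∈ (Projectivization.mk ℂ l.rep l.rep_nonzero).submodule := by
    rw [Projectivization.submodule_mk]
    exact Submodule.mem_span_singleton_self _
  rwa [l.mk_rep] at this

theorem reducesTo_step {n : ℕ} (i : Fin n) (l l' : ℙ ℂ (Fin n → ℂ))
    (h : ∀ v ∈ l.submodule, (gMat n i 0).mulVec v ∈ l'.submodule) :
    ∃ a, reducesTo l' = (reducesTo l).map (gSeries i) ⊔ Submodule.span (PowerSeries ℂ) {a} := by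
  have hG : ∀ (v : Fin n → ℂ) (j : Fin n), (gMat n i 0).mulVec v j = if j = i then 0 else v j := by
    intro v j
    simp only [gMat, Matrix.mulVec_diagonal]
    split_ifs <;> simp
  have hmap : (reducesTo l).map (gSeries i) ≤ reducesTo l' := by
    rintro _ ⟨c, hc, rfl⟩
    rw [mem_reducesTo]
    have := h _ hc
    convert this using 1
    funext j
    rw [hG, gSeries_apply]
    split_ifs <;> simp
  by_cases hi : (Pi.single i 1 : Fin n → ℂ) ∈ l.submodule
  · refine ⟨fun j => PowerSeries.C (l'.rep j), le_antisymm ?_ (sup_le hmap ?_)⟩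
    · intro c hc
      rw [mem_reducesTo, ← l'.mk_rep, Projectivization.submodule_mk,
        Submodule.mem_span_singleton] at hc
      obtain ⟨s, hs⟩ := hc
      obtain ⟨d, hd⟩ := exists_eq_X_smul (fun j => c j - PowerSeries.C s * PowerSeries.C (l'.rep j))
        (fun j => by
          have := congrFun hs j
          simp only [Pi.smul_apply, smul_eq_mul] at this
          simp [← this])
      refine Submodule.mem_sup.2 ⟨gSeries i (fun j => if j = i then d j else PowerSeries.X * d j),
        Submodule.mem_map_of_mem ?_, _,
        Submodule.smul_mem _ (PowerSeries.C s) (Submodule.mem_span_singleton_self _), ?_⟩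
      · rw [mem_reducesTo]
        convert l.submodule.smul_mem (PowerSeries.constantCoeff (d i)) hi using 1
        funext j
        by_cases hj : j = i
        · subst hj; simp
        · simp [hj]
      · funext j
        have := hd j
        simp only [Pi.add_apply, gSeries_apply, Pi.smul_apply, smul_eq_mul]
        rw [eq_comm, ← sub_eq_iff_eq_add, this]
        split_ifs <;> rfl
    · rw [Submodule.span_le, Set.singleton_subset_iff, SetLike.mem_coe, mem_reducesTo]
      simp only [PowerSeries.constantCoeff_C]
      exact rep_mem_submodule l'
  · refine ⟨fun j => if j = i then PowerSeries.X else 0, le_antisymm ?_ (sup_le hmap ?_)⟩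
    · have hl : l.rep ∈ l.submodule := rep_mem_submodule l
      have h0 : (gMat n i 0).mulVec l.rep ≠ 0 := by
        intro h0
        have hz : ∀ j, j ≠ i → l.rep j = 0 := fun j hj => by
          have := congrFun h0 j
          rwa [hG, if_neg hj] at this
        have hne : l.rep i ≠ 0 := fun hii => l.rep_nonzero (by
          funext j
          by_cases hj : j = i
          · rw [hj, hii]; rfl
          · exact hz j hj)
        apply hi
        convert l.submodule.smul_mem (l.rep i)⁻¹ hl using 1
        funext j
        by_cases hj : j = i
        · subst hj; simp [hne]
        · simp [hj, hz j hj]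
      have hspan : ∀ v ∈ l'.submodule, ∃ s : ℂ, v = s • (gMat n i 0).mulVec l.rep := by
        intro v hv
        have h1 := h _ hl
        rw [← l'.mk_rep, Projectivization.submodule_mk, Submodule.mem_span_singleton] at h1 hv
        obtain ⟨x, hx⟩ := h1
        obtain ⟨y, rfl⟩ := hv
        have hx0 : x ≠ 0 := by
          rintro rfl
          rw [zero_smul] at hx
          exact h0 hx.symm
        refine ⟨y * x⁻¹, ?_⟩
        rw [← hx, smul_smul, mul_assoc, inv_mul_cancel₀ hx0, mul_one]
      intro c hc
      obtain ⟨s, hs⟩ := hspan _ hc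
      obtain ⟨d, hd⟩ := exists_eq_X_smul
        (fun j => c j - gSeries i (fun j => PowerSeries.C (s * l.rep j)) j) (fun j => by
          have := congrFun hs j
          simp only [Pi.smul_apply, smul_eq_mul, hG] at this
          rw [map_sub, this, gSeries_apply]
          split_ifs <;> simp)
      refine Submodule.mem_sup.2 ⟨gSeries i (fun j => PowerSeries.C (s * l.rep j) +
          if j = i then 0 else PowerSeries.X * d j),
        Submodule.mem_map_of_mem ?_, _,
        Submodule.smul_mem _ (d i) (Submodule.mem_span_singleton_self _), ?_⟩
      · rw [mem_reducesTo]
        convert l.submodule.smul_mem s hl using 1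
        funext j
        by_cases hj : j = i <;> simp [hj]
      · funext j
        have := hd j
        simp only [Pi.add_apply, gSeries_apply, Pi.smul_apply, smul_eq_mul] at this ⊢
        by_cases hj : j = i
        · subst hj
          simp only [if_true] at this ⊢
          linear_combination -this
        · simp only [hj, if_false] at this ⊢
          linear_combination -this
    · rw [Submodule.span_le, Set.singleton_subset_iff, SetLike.mem_coe, mem_reducesTo]
      convert l'.submodule.zero_mem using 1
      funext j
      by_cases hj : j = i <;> simp [hj]

theorem latticeCoord_apply (n m : ℕ) (c : Fin n → PowerSeries ℂ) (j : Fin n) :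
    latticeCoord n m c j = (if (j : ℕ) < m then ((tUnit⁻¹ : (LaurentSeries ℂ)ˣ) : LaurentSeries ℂ)
      else 1) * algebraMap (PowerSeries ℂ) (LaurentSeries ℂ) (c j) := rfl

theorem algebraMap_X : algebraMap (PowerSeries ℂ) (LaurentSeries ℂ) PowerSeries.X = tUnit := by
  simp [tUnit, LaurentSeries.coe_algebraMap]

theorem latticeCoord_gSeries {n : ℕ} (i : Fin n) (c : Fin n → PowerSeries ℂ) :
    latticeCoord n (i + 1) (gSeries i c) = latticeCoord n i c := by
  funext j
  rw [latticeCoord_apply, latticeCoord_apply, gSeries_apply]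
  rcases lt_trichotomy (j : ℕ) (i : ℕ) with h | h | h
  · have e : j ≠ i := fun e => h.ne (congrArg Fin.val e)
    simp only [h, show (j : ℕ) < i + 1 by omega, e, if_true, if_false]
  · have e : j = i := Fin.ext h
    subst e
    simp only [lt_irrefl, Nat.lt_succ_self, if_true, if_false]
    rw [map_mul, algebraMap_X, ← mul_assoc, Units.inv_mul]
  · have e : j ≠ i := fun e => h.ne' (congrArg Fin.val e)
    simp only [show ¬ (j : ℕ) < i by omega, show ¬ (j : ℕ) < i + 1 by omega, e, if_false]

theorem X_smul_latticeCoord {n : ℕ} (c : Fin n → PowerSeries ℂ) :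
    (PowerSeries.X : PowerSeries ℂ) • latticeCoord n n c = latticeCoord n 0 c := by
  funext j
  rw [Pi.smul_apply, latticeCoord_apply, latticeCoord_apply, if_pos j.2, if_neg (by omega),
    Algebra.smul_def, algebraMap_X, ← mul_assoc, Units.mul_inv]

open scoped Pointwise in
theorem chain_eq {R M : Type*} [CommRing R] [AddCommGroup M] [Module R M] (r : R)
    (hr : r ∈ Ideal.jacobson (⊥ : Ideal R)) (n : ℕ) (S T : ℕ → Submodule R M) (v : ℕ → M)
    (hS : ∀ m < n, S (m + 1) = S m ⊔ Submodule.span R {v m})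
    (hT : ∀ m < n, T (m + 1) = T m ⊔ Submodule.span R {v m})
    (hS0 : S 0 = r • S n) (hT0 : T 0 = r • T n) (hSf : (S 0).FG) (hTf : (T 0).FG) :
    ∀ m ≤ n, S m = T m := by
  have hexp : ∀ P : ℕ → Submodule R M, (∀ m < n, P (m + 1) = P m ⊔ Submodule.span R {v m}) →
      ∀ m ≤ n, P m = P 0 ⊔ Submodule.span R (v '' Set.Iio m) := by
    intro P hP m
    induction m with
    | zero => intro _; simp
    | succ m ih =>
      intro hm
      rw [hP m (by omega), ih (by omega), sup_assoc, ← Submodule.span_union, ← Set.image_singleton,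
        ← Set.image_union]
      congr 3
      ext k
      simp only [Set.mem_union, Set.mem_Iio, Set.mem_singleton_iff]
      omega
  have hzero : ∀ P : ℕ → Submodule R M, (∀ m < n, P (m + 1) = P m ⊔ Submodule.span R {v m}) →
      P 0 = r • P n → (P 0).FG → P 0 = r • Submodule.span R (v '' Set.Iio n) := by
    intro P hP h0 hf
    have h1 : P 0 = r • P 0 ⊔ r • Submodule.span R (v '' Set.Iio n) := by
      rw [← Submodule.smul_sup', ← hexp P hP n le_rfl]
      exact h0
    apply le_antisymm
    · refine Submodule.le_of_le_smul_of_le_jacobson_bot (I := Ideal.span {r}) hf ?_ ?_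
      · rwa [Ideal.span_le, Set.singleton_subset_iff]
      · rw [Submodule.ideal_span_singleton_smul, sup_comm]
        exact h1.le
    · rw [h1]
      exact le_sup_right
  intro m hm
  rw [hexp S hS m hm, hexp T hT m hm, hzero S hS hS0 hSf, hzero T hT hT0 hTf]

open scoped Pointwise in
theorem exists_latticeChain {n : ℕ} [NeZero n] (q : GrBar n) (hq : q ∈ GrBar.special n) :
    ∃ g : GL (Fin n) (LaurentSeries ℂ),
      ∀ i : Fin n, translateLattice g (stdLattice n i) = lineLattice i (q.L i) := by
  have hq0 : q.y = 0 := hq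
  have hstep : ∀ i : Fin n, ∃ v, lineLattice ((i : ℕ) + 1) (q.L (i + 1)) =
      lineLattice i (q.L i) ⊔ Submodule.span (PowerSeries ℂ) {v} := by
    intro i
    obtain ⟨a, ha⟩ := reducesTo_step i (q.L i) (q.L (i + 1)) (fun v hv => hq0 ▸ q.incl i v hv)
    refine ⟨latticeCoord n (i + 1) a, ?_⟩
    unfold lineLattice
    rw [ha, Submodule.map_sup, Submodule.map_span, Set.image_singleton, ← Submodule.map_comp]
    congr 2
    exact LinearMap.ext (latticeCoord_gSeries i)
  choose v hv using hstep
  let A : Matrix (Fin n) (Fin n) (LaurentSeries ℂ) := Matrix.of fun r i => tUnit * v i r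
  let Φ := (Matrix.toLin' A).restrictScalars (PowerSeries ℂ)
  have hA : ∀ i : Fin n, Φ (latticeCoord n (i + 1) (Pi.single i 1)) = v i := by
    intro i
    have e : latticeCoord n (i + 1) (Pi.single i 1) =
        Pi.single i ((tUnit⁻¹ : (LaurentSeries ℂ)ˣ) : LaurentSeries ℂ) := by
      funext j
      rw [latticeCoord_apply]
      by_cases hj : j = i
      · subst hj; simp
      · simp [hj]
    rw [e]
    funext r
    change A.mulVec (Pi.single i ((tUnit⁻¹ : (LaurentSeries ℂ)ˣ) : LaurentSeries ℂ)) r = v i r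
    rw [Matrix.mulVec_single]
    simp only [op_smul_eq_smul, Pi.smul_apply, Matrix.col_apply, Matrix.of_apply, A, smul_eq_mul]
    rw [← mul_assoc, Units.inv_mul, one_mul]
  have hstd : ∀ i : Fin n, (stdLattice n (i + 1)).map Φ =
      (stdLattice n i).map Φ ⊔ Submodule.span (PowerSeries ℂ) {v i} := by
    intro i
    rw [← hA i, ← Set.image_singleton, ← Submodule.map_span, ← Submodule.map_sup]
    congr 1
    apply le_antisymm
    · rintro _ ⟨c, rfl⟩
      refine Submodule.mem_sup.2 ⟨_, ⟨fun j => if j = i then 0 else c j, rfl⟩, _,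
        Submodule.smul_mem _ (c i) (Submodule.mem_span_singleton_self _), ?_⟩
      rw [← latticeCoord_gSeries, ← map_smul, ← map_add]
      congr 1
      funext j
      rw [Pi.add_apply, gSeries_apply]
      by_cases hj : j = i
      · subst hj; simp
      · simp [hj]
    · refine sup_le ?_ ?_
      · rintro _ ⟨c, rfl⟩
        exact ⟨gSeries i c, latticeCoord_gSeries i c⟩
      · rw [Submodule.span_le, Set.singleton_subset_iff]
        exact ⟨_, rfl⟩
  have hX : (PowerSeries.X : PowerSeries ℂ) ∈ Ideal.jacobson (⊥ : Ideal (PowerSeries ℂ)) := by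
    rw [IsLocalRing.jacobson_eq_maximalIdeal _ bot_ne_top, IsLocalRing.mem_maximalIdeal,
      mem_nonunits_iff]
    exact PowerSeries.X_prime.not_isUnit
  have hmain := chain_eq (PowerSeries.X : PowerSeries ℂ) hX n
    (fun m => (stdLattice n m).map Φ) (fun m => lineLattice m (q.L (Fin.ofNat n m)))
    (fun m => v (Fin.ofNat n m))
    (fun m hm => by
      have := hstd (Fin.ofNat n m)
      rwa [Fin.val_ofNat, Nat.mod_eq_of_lt hm] at this)
    (fun m hm => by
      have := hv (Fin.ofNat n m)
      rw [Fin.val_ofNat, Nat.mod_eq_of_lt hm] at this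
      have e : Fin.ofNat n (m + 1) = Fin.ofNat n m + 1 := by
        apply Fin.ext
        rw [Fin.val_add, Fin.val_one', Fin.val_ofNat, Fin.val_ofNat, Nat.mod_add_mod,
          Nat.add_mod_mod]
      simp only [e]
      exact this)
    (by
      rw [← Submodule.map_pointwise_smul]
      congr 1
      ext y
      constructor
      · rintro ⟨c, rfl⟩
        rw [← X_smul_latticeCoord]
        exact Submodule.smul_mem_pointwise_smul _ _ _ ⟨c, rfl⟩
      · intro hy
        obtain ⟨_, ⟨c, rfl⟩, rfl⟩ := (Submodule.mem_smul_pointwise_iff_exists _ _ _).1 hy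
        exact ⟨c, (X_smul_latticeCoord c).symm⟩)
    (by
      have e : Fin.ofNat n n = Fin.ofNat n 0 := by
        apply Fin.ext
        simp
      simp only [e]
      ext y
      constructor
      · rintro ⟨c, hc, rfl⟩
        rw [← X_smul_latticeCoord]
        exact Submodule.smul_mem_pointwise_smul _ _ _ ⟨c, hc, rfl⟩
      · intro hy
        obtain ⟨_, ⟨c, hc, rfl⟩, rfl⟩ := (Submodule.mem_smul_pointwise_iff_exists _ _ _).1 hy
        exact ⟨c, hc, (X_smul_latticeCoord c).symm⟩)
    (by
      refine Submodule.FG.map _ ?_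
      unfold stdLattice
      rw [LinearMap.range_eq_map]
      exact Submodule.FG.map _ Module.Finite.fg_top)
    (Submodule.FG.map _ (IsNoetherian.noetherian _))
  have hcol : ∀ j : Fin n, ∃ b : Fin n → LaurentSeries ℂ, A.mulVec b = Pi.single j 1 := by
    intro j
    have h0 : latticeCoord n 0 (Pi.single j PowerSeries.X) ∈ (stdLattice n 0).map Φ := by
      rw [hmain 0 (Nat.zero_le n)]
      refine ⟨_, ?_, rfl⟩
      rw [SetLike.mem_coe, mem_reducesTo]
      convert (q.L _).submodule.zero_mem using 1
      funext k
      by_cases hk : k = j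
      · subst hk; simp
      · simp [hk]
    obtain ⟨b, -, hb⟩ := h0
    refine ⟨((tUnit⁻¹ : (LaurentSeries ℂ)ˣ) : LaurentSeries ℂ) • b, ?_⟩
    rw [Matrix.mulVec_smul]
    change _ • (Φ b) = _
    rw [hb]
    funext k
    rw [Pi.smul_apply, latticeCoord_apply]
    by_cases hk : k = j
    · subst hk
      simp [algebraMap_X, -LaurentSeries.coe_algebraMap]
    · simp [hk]
  choose b hb using hcol
  have hAB : A * Matrix.of (fun r j => b j r) = 1 := by
    ext r j
    have := congrFun (hb j) r
    rw [Matrix.mul_apply]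
    simp only [Matrix.mulVec, dotProduct] at this
    simp only [Matrix.of_apply]
    rw [this, Matrix.one_apply, Pi.single_apply]
  refine ⟨⟨A, _, hAB, mul_eq_one_comm.1 hAB⟩, fun i => ?_⟩
  have := hmain i i.2.le
  have e : Fin.ofNat n (i : ℕ) = i := Fin.ext (by rw [Fin.val_ofNat, Nat.mod_eq_of_lt i.2])
  simp only [e] at this
  exact this

/-- The embedding of the special fiber in the affine flag variety: `(0, L_1, …, L_n)` goes to the class of
the matrices `g` that carry the standard lattice chain `λ_0, …, λ_{n-1}` to the chain of the preimages of
`L_1, …, L_n` in `λ_0, …, λ_{n-1}`. (The class does not depend on `g`, because the stabilizer of the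
standard chain is the Iwahori subgroup.) -/
def toFl {n : ℕ} [NeZero n] (q : GrBar.special n) : Fl n :=
  QuotientGroup.mk (Matrix.ProjGenLinGroup.mk (exists_latticeChain q.1 q.2).choose)

/-- The stratum `Fl_w` as a subset of the global Schubert variety, via the embedding of the special
fiber. -/
def specialStratum {n : ℕ} [NeZero n] (w : WExt n) : Set (GrBar n) :=
  {q | ∃ hq : q ∈ GrBar.special n, toFl ⟨q, hq⟩ ∈ flOrbit w}

/-- The stratum `Fl_I = Fl_{w_I}`, for `I ⊊ {1, …, n}`. -/
def flStratum {n : ℕ} [NeZero n] (I : Finset (Fin n)) (hI : I ≠ Finset.univ) : Set (GrBar n) :=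
  specialStratum (wElt I hI)

end GlobalSchubert

end

open scoped LinearAlgebra.Projectivization MatrixGroups

noncomputable section

namespace GlobalSchubert

/-! ### The image of the chart -/

/-! The vectors `u_k` satisfy `g_k(x_1 ⋯ x_n) u_k = x_k u_{k+1}` and have `k`-th coordinate 1
(`uVec_succ`, `uVec_self`). These two properties determine them, and also force `y = x_1 ⋯ x_n`
(`eq_uVec`, `eq_prod_of_uVec_succ`).

Open embedding and equivariance both come from this uniqueness. Take a point of `X` at which the
`k`-th coordinate of `L_k` is nonzero for all `k`. Scaling the lines to make these coordinates 1
turns the inclusions `g_k(y) L_k ⊂ L_{k+1}` into the recursion, with `x_k` the proportionality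
factor. So the image of `u` is exactly this open set, and the inverse is given by quotients whose
denominators are the diagonal coordinates. Polynomials pull back to polynomials, and conversely
become multihomogeneous after clearing these denominators (`exists_homogenization`). For
equivariance, the torus translates of the `u_k`, renormalized, satisfy the recursion with parameters
`α_k(t) x_k`.

On the special fiber, an element of the Iwahori group acts on `λ_m / t λ_m` by a matrix that is
upper triangular for the cyclic order starting at `m` (`translateLattice_iwahoriElt`). With `e_{k+n}
= t⁻¹ e_k`, the element `w_I` becomes a permutation of `ℤ`: it fixes the residues in `I` and sends
every other integer to the next one outside `I`. Hence the point `w_I` has as its `m`-th line the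
coordinate line of the first index outside `I`, counted cyclically from `m` (`exists_wElt_lift`).
For `x` in the stratum of `I`, one Iwahori matrix with entries `1 / (u_r)_c` above the diagonal
carries these lines to the `u_m(x)`, so `u(x)` lies in `Fl_I`.

The converse inclusion is formal once the `Fl_I` are pairwise disjoint, since the strata cover the
zero fiber of `𝔸ⁿ`. Disjointness holds because the first index outside `I` from each `m` is an
invariant of the orbit, and it equals `m` exactly when `m ∉ I` (`firstOutside_eq`,
`eq_of_mem_flOrbit`). Finally, every orbit meets the image: row `m` of the matrix acting at `m` is
unconstrained apart from its nonzero diagonal entry, so it can be chosen to make the `m`-th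
coordinate of each moved line nonzero. -/

theorem val_sub_succ_lt {n : ℕ} [NeZero n] {j k : Fin n} (h : j ≠ k) :
    ((j - (k + 1) : Fin n) : ℕ) < ((j - k : Fin n) : ℕ) := by
  have h1 := fin_val_sub_one (j - k)
  rw [sub_sub] at h1
  have h2 : ((j - k : Fin n) : ℕ) ≠ 0 := fun h' => h (by
    rw [← sub_eq_zero]
    exact Fin.ext (by rw [h', Fin.val_zero]))
  rw [if_neg h2] at h1
  omega

/-- The recursion of `uVec_succ` characterizes the vectors `uVec k x`. -/
theorem eq_uVec {n : ℕ} [NeZero n] (x : Fin n → ℂ) (y : ℂ) (v : Fin n → Fin n → ℂ)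
    (h1 : ∀ k, v k k = 1)
    (h2 : ∀ k j, (if j = k then y else 1) * v k j = x k * v (k + 1) j) (k j : Fin n) :
    v k j = uVec k x j := by
  -- Induction on the cyclic distance from `k` up to `j`: the recursion passes from `k` to `k + 1`,
  -- and at distance 0 both sides are 1.
  induction hN : ((j - k : Fin n) : ℕ) using Nat.strong_induction_on generalizing k with
  | _ N ih =>
    by_cases hjk : j = k
    · subst hjk
      rw [h1, uVec_self]
    · have e1 := h2 k j
      have e2 := uVec_succ k j x
      rw [if_neg hjk, one_mul] at e1 e2
      rw [e1, e2, ih _ (hN ▸ val_sub_succ_lt hjk) (k + 1) rfl]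

/-- At `k = j = 0` the two recursions express `y` and the product of the `x_i` as the same number `x
0 * uVec 1 x 0`. -/
theorem eq_prod_of_uVec_succ {n : ℕ} [NeZero n] (x : Fin n → ℂ) (y : ℂ) (v : Fin n → Fin n → ℂ)
    (h1 : ∀ k, v k k = 1)
    (h2 : ∀ k j, (if j = k then y else 1) * v k j = x k * v (k + 1) j) : y = ∏ i, x i := by
  have e1 := h2 0 0
  have e2 := uVec_succ 0 0 x
  rw [if_pos rfl, h1, mul_one, eq_uVec x y v h1 h2] at e1
  rw [if_pos rfl, uVec_self, mul_one] at e2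
  rw [e1, e2]

/-- The open subset of the global Schubert variety where, for all `k`, the `k`-th coordinate of `L_k`
does not vanish. -/
def chartDomain (n : ℕ) [NeZero n] : Set (GrBar n) := {q | ∀ k, (q.L k).rep k ≠ 0}

/-- The numerator of the `k`-th coordinate of the inverse of the chart. -/
def invNum {n : ℕ} [NeZero n] (k : Fin n) : MvPolynomial (Option (Fin n × Fin n)) ℂ :=
  -- The factor `y` enters only for `n = 1`, where `k + 1 = k` is the coordinate that `g_k(y)`
  -- scales.
  (if k + 1 = k then MvPolynomial.X none else 1) * MvPolynomial.X (some (k, k + 1))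

/-- The inverse of the chart on `chartDomain n`. -/
def chartInv {n : ℕ} [NeZero n] (q : GrBar n) : AffSpace n :=
  ⟨fun k => q.evalRep (invNum k) / (q.L k).rep k⟩

theorem evalRep_invNum {n : ℕ} [NeZero n] (q : GrBar n) (k : Fin n) :
    q.evalRep (invNum k) = (if k + 1 = k then q.y else 1) * (q.L k).rep (k + 1) := by
  unfold GrBar.evalRep invNum
  split_ifs <;> simp

theorem mem_mk_submodule {n : ℕ} {v w : Fin n → ℂ} {hv : v ≠ 0} :
    w ∈ (Projectivization.mk ℂ v hv).submodule ↔ ∃ c : ℂ, c • v = w := by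
  rw [Projectivization.submodule_mk, Submodule.mem_span_singleton]

theorem mem_submodule_iff {n : ℕ} {l : ℙ ℂ (Fin n → ℂ)} {w : Fin n → ℂ} :
    w ∈ l.submodule ↔ ∃ c : ℂ, c • l.rep = w := by
  rw [Projectivization.submodule_eq, Submodule.mem_span_singleton]

theorem GrBar.rep_succ {n : ℕ} [NeZero n] (q : GrBar n) (k : Fin n) :
    ∃ c : ℂ, ∀ j, (if j = k then q.y else 1) * (q.L k).rep j = c * (q.L (k + 1)).rep j := by
  obtain ⟨c, hc⟩ := mem_submodule_iff.1 (q.incl k _ (rep_mem_submodule _))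
  refine ⟨c, fun j => ?_⟩
  have := congrFun hc j
  simp only [gMat, Matrix.mulVec_diagonal, Pi.smul_apply, smul_eq_mul] at this
  exact this.symm

/-- Representatives scaled to have diagonal coordinate 1 satisfy the recursion with parameters
`chartInv q`, so uniqueness identifies them with the `uVec`. -/
theorem chart_chartInv {n : ℕ} [NeZero n] {q : GrBar n} (hq : q ∈ chartDomain n) :
    chart n (chartInv q) = q := by
  have h1 : ∀ k, (fun k j => (q.L k).rep j / (q.L k).rep k) k k = 1 := fun k => div_self (hq k)
  have h2 : ∀ k j, (if j = k then q.y else 1) * (fun k j => (q.L k).rep j / (q.L k).rep k) k j =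
      (chartInv q).coord k * (fun k j => (q.L k).rep j / (q.L k).rep k) (k + 1) j := by
    intro k j
    obtain ⟨c, hc⟩ := q.rep_succ k
    -- The scalar `c` of the inclusion is read off in the coordinate `k + 1`, where the
    -- representative of `L_{k+1}` is nonzero.
    have e : (chartInv q).coord k = c * (q.L (k + 1)).rep (k + 1) / (q.L k).rep k := by
      unfold chartInv
      simp only
      rw [evalRep_invNum, hc (k + 1)]
    simp only
    rw [e, ← mul_div_assoc, hc j]
    have := hq k
    have := hq (k + 1)
    field_simp
  refine GrBar.ext ?_ (funext fun k => ?_)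
  · exact (eq_prod_of_uVec_succ _ _ _ h1 h2).symm
  · conv_rhs => rw [← (q.L k).mk_rep]
    refine (Projectivization.mk_eq_mk_iff' ℂ _ _ _ _).2 ⟨((q.L k).rep k)⁻¹, funext fun j => ?_⟩
    rw [← eq_uVec _ _ _ h1 h2 k j, Pi.smul_apply, smul_eq_mul, div_eq_inv_mul]

theorem exists_chart_rep {n : ℕ} [NeZero n] (x : AffSpace n) :
    ∃ c : Fin n → ℂˣ, ∀ k j, ((chart n x).L k).rep j = c k * uVec k x.coord j := by
  choose c hc using fun k => Projectivization.exists_smul_eq_mk_rep ℂ _ (uVec_ne_zero k x.coord)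
  exact ⟨c, fun k j => (congrFun (hc k) j).symm⟩

theorem chart_mem_chartDomain {n : ℕ} [NeZero n] (x : AffSpace n) :
    chart n x ∈ chartDomain n := by
  obtain ⟨c, hc⟩ := exists_chart_rep x
  intro k
  rw [hc, uVec_self, mul_one]
  exact (c k).ne_zero

theorem uVec_succ_self {n : ℕ} [NeZero n] (k : Fin n) (x : Fin n → ℂ) :
    (if k + 1 = k then ∏ i, x i else 1) * uVec k x (k + 1) = x k := by
  rw [uVec_succ, uVec_self, mul_one]

theorem chartInv_chart {n : ℕ} [NeZero n] (x : AffSpace n) : chartInv (chart n x) = x := by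
  obtain ⟨c, hc⟩ := exists_chart_rep x
  refine AffSpace.ext (funext fun k => ?_)
  unfold chartInv
  simp only
  rw [evalRep_invNum, hc, hc, uVec_self, mul_one]
  have h := (c k).ne_zero
  have := uVec_succ_self k x.coord
  rw [div_eq_iff h, ← this]
  change (if k + 1 = k then ∏ i, x.coord i else 1) * _ = _
  ring

theorem chart_injective (n : ℕ) [NeZero n] : Function.Injective (chart n) :=
  Function.LeftInverse.injective chartInv_chart

theorem range_chart (n : ℕ) [NeZero n] : Set.range (chart n) = chartDomain n :=
  Set.Subset.antisymm (Set.range_subset_iff.2 chart_mem_chartDomain)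
    fun _ hq => ⟨_, chart_chartInv hq⟩

/-! ### Polynomials on the chart -/

theorem eval_scale {n : ℕ} {F : MvPolynomial (Option (Fin n × Fin n)) ℂ} {d : Fin n → ℕ}
    (hF : IsMultihomogeneous F d) (c : Fin n → ℂ) (p : Option (Fin n × Fin n) → ℂ) :
    MvPolynomial.eval (fun s => (match s with | none => 1 | some (i, _) => c i) * p s) F =
      (∏ i, c i ^ d i) * MvPolynomial.eval p F := by
  rw [MvPolynomial.eval_eq', MvPolynomial.eval_eq', Finset.mul_sum]
  refine Finset.sum_congr rfl fun m hm => ?_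
  have hd := hF (MvPolynomial.mem_support_iff.1 hm)
  rw [Finsupp.weight_apply, Finsupp.sum_fintype _ _ (by simp)] at hd
  have hd' : ∀ i, d i = ∑ j, m (some (i, j)) := by
    intro i
    rw [← hd]
    simp only [multiWeight, Fintype.sum_option, Fintype.sum_prod_type, Finset.sum_apply,
      Pi.smul_apply, Pi.single_apply, smul_zero, zero_add, Pi.zero_apply]
    rw [Finset.sum_comm]
    simp
  simp only [mul_pow, Finset.prod_mul_distrib]
  rw [mul_left_comm]
  congr 1
  rw [Fintype.prod_option, Fintype.prod_prod_type]
  simp [hd', Finset.prod_pow_eq_pow_sum]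

/-- Homogeneous coordinates of a point of the chart. -/
def chartCoord {n : ℕ} [NeZero n] (x : AffSpace n) : Option (Fin n × Fin n) → ℂ
  | none => ∏ i, x.coord i
  | some (k, j) => uVec k x.coord j

/-- The chosen representatives differ from the `uVec` by nonzero scalars. The resulting factor
depends on the multidegree but not on `F`, so it cancels in quotients of equal multidegree. -/
theorem exists_unit_evalRep_chart {n : ℕ} [NeZero n] (d : Fin n → ℕ) (x : AffSpace n) :
    ∃ c : ℂˣ, ∀ F, IsMultihomogeneous F d →
      (chart n x).evalRep F = c * MvPolynomial.eval (chartCoord x) F := by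
  obtain ⟨c, hc⟩ := exists_chart_rep x
  refine ⟨∏ i, c i ^ d i, fun F hF => ?_⟩
  have := eval_scale hF (fun i => c i) (chartCoord x)
  simp only [Units.coe_prod, Units.val_pow_eq_pow_val]
  rw [← this]
  unfold GrBar.evalRep
  congr 2
  funext s
  rcases s with _ | ⟨k, j⟩
  · simp [chartCoord, chart]
  · simp [chartCoord, hc]

theorem exists_pullback {n : ℕ} [NeZero n] (F : MvPolynomial (Option (Fin n × Fin n)) ℂ) :
    ∃ P : MvPolynomial (Fin n) ℂ, ∀ x : AffSpace n,
      MvPolynomial.eval x.coord P = MvPolynomial.eval (chartCoord x) F := by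
  have h : ∀ s : Option (Fin n × Fin n), ∃ P : MvPolynomial (Fin n) ℂ, ∀ x : AffSpace n,
      MvPolynomial.eval x.coord P = chartCoord x s := by
    rintro (_ | ⟨k, j⟩)
    · exact ⟨∏ i, MvPolynomial.X i, fun x => by simp [chartCoord]⟩
    · simp only [chartCoord, uVec, pFun]
      split_ifs
      · exact ⟨1, fun x => by simp⟩
      · exact ⟨∏ i ∈ Finset.Icc k (j - 1), MvPolynomial.X i, fun x => by simp⟩
      · exact ⟨(∏ i ∈ Finset.Ici k, MvPolynomial.X i) * ∏ i ∈ Finset.Iic (j - 1), MvPolynomial.X i,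
          fun x => by simp⟩
  choose P hP using h
  refine ⟨MvPolynomial.bind₁ P F, fun x => ?_⟩
  rw [MvPolynomial.eval, MvPolynomial.eval₂Hom_bind₁]
  exact congrArg (fun p => MvPolynomial.eval p F) (funext fun s => hP s x)

theorem evalRep_mul {n : ℕ} [NeZero n] (q : GrBar n) (F G : MvPolynomial (Option (Fin n × Fin n)) ℂ) :
    q.evalRep (F * G) = q.evalRep F * q.evalRep G := map_mul _ _ _

theorem evalRep_add {n : ℕ} [NeZero n] (q : GrBar n) (F G : MvPolynomial (Option (Fin n × Fin n)) ℂ) :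
    q.evalRep (F + G) = q.evalRep F + q.evalRep G := map_add _ _ _

/-- The monomial `∏_k X_{k,k}^{d_k}`. -/
def diagMonomial {n : ℕ} (d : Fin n → ℕ) : MvPolynomial (Option (Fin n × Fin n)) ℂ :=
  ∏ k, MvPolynomial.X (some (k, k)) ^ d k

theorem isMultihomogeneous_X_some {n : ℕ} (k j : Fin n) :
    IsMultihomogeneous (MvPolynomial.X (some (k, j))) (Pi.single k 1) :=
  MvPolynomial.isWeightedHomogeneous_X ℂ (multiWeight n) (some (k, j))

theorem isMultihomogeneous_diagMonomial {n : ℕ} (d : Fin n → ℕ) :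
    IsMultihomogeneous (diagMonomial d) d := by
  have := MvPolynomial.IsWeightedHomogeneous.prod Finset.univ
    (fun k : Fin n => (MvPolynomial.X (some (k, k)) : MvPolynomial (Option (Fin n × Fin n)) ℂ) ^ d k)
    (fun k => d k • Pi.single k 1) (w := multiWeight n)
    (fun k _ => (isMultihomogeneous_X_some k k).pow (d k))
  rwa [show ∑ k, d k • Pi.single k 1 = d by funext i; simp [Pi.single_apply]] at this

theorem evalRep_diagMonomial {n : ℕ} [NeZero n] (q : GrBar n) (d : Fin n → ℕ) :
    q.evalRep (diagMonomial d) = ∏ k, (q.L k).rep k ^ d k := by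
  simp [GrBar.evalRep, diagMonomial]

theorem evalRep_diagMonomial_ne_zero {n : ℕ} [NeZero n] {q : GrBar n} (hq : q ∈ chartDomain n)
    (d : Fin n → ℕ) : q.evalRep (diagMonomial d) ≠ 0 := by
  rw [evalRep_diagMonomial]
  exact Finset.prod_ne_zero_iff.2 fun k _ => pow_ne_zero _ (hq k)

theorem isMultihomogeneous_invNum {n : ℕ} [NeZero n] (k : Fin n) :
    IsMultihomogeneous (invNum k) (Pi.single k 1) := by
  unfold invNum
  have h : IsMultihomogeneous (if k + 1 = k then MvPolynomial.X none else 1 :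
      MvPolynomial (Option (Fin n × Fin n)) ℂ) 0 := by
    split_ifs
    · exact MvPolynomial.isWeightedHomogeneous_X ℂ (multiWeight n) none
    · exact MvPolynomial.isWeightedHomogeneous_one ℂ (multiWeight n)
  have := MvPolynomial.IsWeightedHomogeneous.mul h (isMultihomogeneous_X_some k (k + 1))
  rwa [zero_add] at this

/-- Multihomogenization of polynomials on `𝔸ⁿ`. -/
theorem exists_homogenization {n : ℕ} [NeZero n] (P : MvPolynomial (Fin n) ℂ) :
    ∃ (d : Fin n → ℕ) (F : MvPolynomial (Option (Fin n × Fin n)) ℂ), IsMultihomogeneous F d ∧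
      ∀ q ∈ chartDomain n, q.evalRep F =
        q.evalRep (diagMonomial d) * MvPolynomial.eval (chartInv q).coord P := by
  induction P using MvPolynomial.induction_on with
  | C a =>
    refine ⟨0, MvPolynomial.C a, MvPolynomial.isWeightedHomogeneous_C (multiWeight n) a, fun q _ => ?_⟩
    rw [evalRep_diagMonomial]
    simp [GrBar.evalRep]
  | add P Q hP hQ =>
    obtain ⟨d, F, hF, hF'⟩ := hP
    obtain ⟨e, G, hG, hG'⟩ := hQ
    -- Addition over a common denominator: `F / X^d + G / X^e = (F X^e + X^d G) / X^(d+e)`, where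
    -- `X^d` stands for `diagMonomial d`.
    refine ⟨d + e, F * diagMonomial e + diagMonomial d * G,
      (hF.mul (isMultihomogeneous_diagMonomial e)).add
        ((isMultihomogeneous_diagMonomial d).mul hG), fun q hq => ?_⟩
    rw [evalRep_add, evalRep_mul, evalRep_mul, hF' q hq, hG' q hq, map_add]
    have : q.evalRep (diagMonomial (d + e)) =
        q.evalRep (diagMonomial d) * q.evalRep (diagMonomial e) := by
      simp [evalRep_diagMonomial, pow_add, Finset.prod_mul_distrib]
    rw [this]
    ring
  | mul_X P k hP =>
    obtain ⟨d, F, hF, hF'⟩ := hP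
    refine ⟨d + Pi.single k 1, F * invNum k, hF.mul (isMultihomogeneous_invNum k), fun q hq => ?_⟩
    rw [evalRep_mul, hF' q hq, map_mul, MvPolynomial.eval_X]
    have : q.evalRep (diagMonomial (d + Pi.single k 1)) =
        q.evalRep (diagMonomial d) * (q.L k).rep k := by
      simp only [evalRep_diagMonomial, Pi.add_apply, pow_add, Finset.prod_mul_distrib]
      congr 1
      simp [Pi.single_apply, pow_ite]
    have h := hq k
    rw [this]
    unfold chartInv
    simp only
    field_simp

/-! ### The chart is an open embedding -/

theorem isOpen_ne_zero {n : ℕ} [NeZero n] {d : Fin n → ℕ}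
    {F : MvPolynomial (Option (Fin n × Fin n)) ℂ} (hF : IsMultihomogeneous F d) :
    IsOpen {q : GrBar n | q.evalRep F ≠ 0} :=
  TopologicalSpace.isOpen_generateFrom_of_mem ⟨d, F, hF, rfl⟩

theorem isOpen_chartDomain (n : ℕ) [NeZero n] : IsOpen (chartDomain n) := by
  have : chartDomain n = {q : GrBar n | q.evalRep (diagMonomial (fun _ => 1)) ≠ 0} := by
    ext q
    rw [Set.mem_ofPred_eq, evalRep_diagMonomial, Finset.prod_ne_zero_iff]
    simp [chartDomain]
  rw [this]
  exact isOpen_ne_zero (isMultihomogeneous_diagMonomial _)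

/-- The two topologies on `𝔸ⁿ` are compared on generators: multihomogeneous polynomials pull back to
polynomials up to a unit, and polynomials homogenize up to a diagonal monomial, which does not
vanish on the image. -/
theorem isOpenEmbedding_chart (n : ℕ) [NeZero n] : Topology.IsOpenEmbedding (chart n) := by
  refine ⟨⟨⟨?_⟩, chart_injective n⟩, by rw [range_chart]; exact isOpen_chartDomain n⟩
  refine le_antisymm ?_ ?_
  · rw [← continuous_iff_le_induced]
    refine continuous_generateFrom_iff.2 ?_
    rintro _ ⟨d, F, hF, rfl⟩
    obtain ⟨P, hP⟩ := exists_pullback F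
    refine TopologicalSpace.isOpen_generateFrom_of_mem ⟨P, Set.ext fun x => ?_⟩
    obtain ⟨c, hc⟩ := exists_unit_evalRep_chart d x
    rw [Set.mem_preimage, Set.mem_ofPred_eq, Set.mem_ofPred_eq, hc F hF, hP]
    simp
  · refine le_generateFrom ?_
    rintro _ ⟨P, rfl⟩
    obtain ⟨d, F, hF, hF'⟩ := exists_homogenization P
    refine ⟨{q | q.evalRep F ≠ 0}, isOpen_ne_zero hF, Set.ext fun x => ?_⟩
    have h := chart_mem_chartDomain x
    rw [Set.mem_preimage, Set.mem_ofPred_eq, Set.mem_ofPred_eq, hF' _ h, chartInv_chart]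
    simp [evalRep_diagMonomial_ne_zero h]

theorem isVarietyOpenEmbedding_chart (n : ℕ) [NeZero n] :
    IsVarietyOpenEmbedding AffSpace.IsRegularOn GrBar.IsRegularOn (chart n) := by
  have hemb := isOpenEmbedding_chart n
  refine ⟨hemb, fun V _ φ => ⟨fun h x hx => ?_, ?_⟩⟩
  · obtain ⟨W, hW, hxW, hWV, d, F, G, hF, hG, hφ⟩ := h _ (Set.mem_image_of_mem _ hx)
    obtain ⟨P, hP⟩ := exists_pullback F
    obtain ⟨Q, hQ⟩ := exists_pullback G
    refine ⟨chart n ⁻¹' W, hW.preimage hemb.continuous, hxW, fun x' hx' => ?_, P, Q, fun x' hx' => ?_⟩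
    · obtain ⟨x'', h1, h2⟩ := hWV hx'
      rwa [← chart_injective n h2]
    · obtain ⟨c, hc⟩ := exists_unit_evalRep_chart d x'
      have h := hφ _ hx'
      rw [hc F hF, hc G hG, ← hP, ← hQ] at h
      refine ⟨right_ne_zero_of_mul h.1, ?_⟩
      rw [Function.comp_apply, h.2, mul_div_mul_left _ _ c.ne_zero]
  · rintro h _ ⟨x, hx, rfl⟩
    obtain ⟨W, hW, hxW, hWV, P, Q, hφ⟩ := h x hx
    obtain ⟨d, F, hF, hF'⟩ := exists_homogenization P
    obtain ⟨e, G, hG, hG'⟩ := exists_homogenization Q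
    -- The numerator and denominator have different multidegrees `d` and `e`; the diagonal monomials
    -- bring both to `d + e`.
    refine ⟨chart n '' W, hemb.isOpenMap W hW, Set.mem_image_of_mem _ hxW, Set.image_mono hWV, d + e,
      F * diagMonomial e, diagMonomial d * G, hF.mul (isMultihomogeneous_diagMonomial e),
      (isMultihomogeneous_diagMonomial d).mul hG, ?_⟩
    rintro _ ⟨x', hx', rfl⟩
    have hq := chart_mem_chartDomain x'
    have h1 := evalRep_diagMonomial_ne_zero hq d
    have h2 := evalRep_diagMonomial_ne_zero hq e
    obtain ⟨h3, h4⟩ := hφ x' hx'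
    rw [evalRep_mul, evalRep_mul, hF' _ hq, hG' _ hq, chartInv_chart]
    refine ⟨mul_ne_zero h1 (mul_ne_zero h2 h3), ?_⟩
    rw [Function.comp_apply] at h4
    rw [h4]
    field_simp

/-! ### Equivariance -/

/-- The torus translates of the `uVec`, rescaled by `(w k)⁻¹` to have `k`-th coordinate 1, satisfy
the recursion with the parameters of `t • x`; uniqueness gives the lines and the coordinate `y` at
once. -/
theorem chart_smul (n : ℕ) [NeZero n] (t : HatT n) (x : AffSpace n) :
    chart n (t • x) = t • chart n x := by
  obtain ⟨⟨_, w, rfl⟩, z⟩ := t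
  set t : HatT n := ⟨⟨diagPGL n ℂ w, w, rfl⟩, z⟩
  have hx : ∀ i, (t • x).coord i =
      (if (i : ℕ) = n - 1 then (z : ℂ) else 1) * (w (i + 1) * (w i : ℂ)⁻¹) * x.coord i := by
    intro i
    change ((alpha n i t : ℂˣ) : ℂ) * x.coord i = _
    unfold alpha
    rw [torusChar_diag]
    change (((if (i : ℕ) = n - 1 then z else 1) * (w (i + 1) * (w i)⁻¹) : ℂˣ) : ℂ) * _ = _
    split_ifs <;> simp
  let v : Fin n → Fin n → ℂ := fun k j => (w k : ℂ)⁻¹ * (w j * rotDiag n k z j * uVec k x.coord j)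
  have h1 : ∀ k, v k k = 1 := by
    intro k
    simp [v, rotDiag, uVec_self]
  have h2 : ∀ k j, (if j = k then z * ∏ i, x.coord i else 1) * v k j =
      (t • x).coord k * v (k + 1) j := by
    intro k j
    -- With `D_k = g_1(z) ⋯ g_{k-1}(z)`, this is `g_k(z) D_k = D_{k+1}`, except that for the last
    -- `k` the left side is the scalar `z` and `D_{k+1}` is the identity. This is the source of the
    -- factor `z` in `α_n`.
    have e : (if j = k then (z : ℂ) else 1) * rotDiag n k z j =
        (if (k : ℕ) = n - 1 then (z : ℂ) else 1) * rotDiag n (k + 1) z j := by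
      have hs := fin_val_succ k
      have hk := k.2
      have hj := j.2
      unfold rotDiag
      simp only [Fin.lt_def, Fin.ext_iff]
      split_ifs at hs ⊢ <;> first | omega | simp
    have e2 := uVec_succ k j x.coord
    have e3 : (if j = k then z * ∏ i, x.coord i else 1 : ℂ) =
      (if j = k then (z : ℂ) else 1) * (if j = k then ∏ i, x.coord i else 1) := by
      split_ifs <;> simp
    have hw := (w (k + 1)).ne_zero
    simp only [v]
    rw [hx, e3]
    calc _ = (w k : ℂ)⁻¹ * w j * ((if j = k then (z : ℂ) else 1) * rotDiag n k z j) *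
          ((if j = k then ∏ i, x.coord i else 1) * uVec k x.coord j) := by ring
      _ = _ := by
        rw [e, e2]
        field_simp
  refine GrBar.ext ?_ (funext fun k => ?_)
  · exact (eq_prod_of_uVec_succ _ _ _ h1 h2).symm
  · change _ = diagPGL n ℂ w • diagPGL n ℂ (rotDiag n k z) •
      Projectivization.mk ℂ (uVec k x.coord) (uVec_ne_zero k x.coord)
    rw [smul_smul, ← map_mul]
    refine (Projectivization.mk_eq_mk_iff' ℂ _ _ _ _).2 ⟨(w k : ℂ)⁻¹, funext fun j => ?_⟩
    rw [← eq_uVec _ _ _ h1 h2 k j, Pi.smul_apply, smul_eq_mul]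
    congr 1
    change ((Matrix.diagonal fun j => (((w * rotDiag n k z) j : ℂˣ) : ℂ)).mulVec _) j = _
    rw [Matrix.mulVec_diagonal, Pi.mul_apply, Units.val_mul]

/-! ### Matrices acting on the standard lattices -/

/-- The inclusion `ℂ[[t]] → ℂ((t))`. -/
abbrev toLaurent : PowerSeries ℂ →+* LaurentSeries ℂ := algebraMap (PowerSeries ℂ) (LaurentSeries ℂ)

theorem toLaurent_injective : Function.Injective toLaurent :=
  FaithfulSMul.algebraMap_injective _ _

/-- The coefficient of `e_j` in the `j`-th basis vector of the lattice `λ_m`. -/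
def latticeScale {n : ℕ} (m : ℕ) (j : Fin n) : (LaurentSeries ℂ)ˣ := if (j : ℕ) < m then tUnit⁻¹ else 1

theorem latticeCoord_eq {n : ℕ} (m : ℕ) (c : Fin n → PowerSeries ℂ) (j : Fin n) :
    latticeCoord n m c j = latticeScale m j * toLaurent (c j) := by
  rw [latticeCoord_apply, latticeScale]
  split_ifs <;> simp

theorem mulVec_latticeCoord {n : ℕ} {m : ℕ} {A B : Matrix (Fin n) (Fin n) (PowerSeries ℂ)}
    (h : ∀ r c, latticeScale m r * toLaurent (B r c) = toLaurent (A r c) * latticeScale m c)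
    (c : Fin n → PowerSeries ℂ) :
    (A.map toLaurent).mulVec (latticeCoord n m c) = latticeCoord n m (B.mulVec c) := by
  funext r
  rw [latticeCoord_eq]
  simp only [Matrix.mulVec, dotProduct, map_sum, map_mul, Finset.mul_sum, Matrix.map_apply]
  refine Finset.sum_congr rfl fun j _ => ?_
  rw [latticeCoord_eq, ← mul_assoc, ← mul_assoc, h]

/-- Passing to the basis of `λ_m` multiplies the entries with `r < m ≤ c` by `t` and divides those
with `c < m ≤ r` by `t`. The latter lie below the diagonal, hence are divisible; the diagonal is
unchanged. -/
theorem exists_mulVec_latticeCoord {n : ℕ} (m : ℕ) {A : Matrix (Fin n) (Fin n) (PowerSeries ℂ)}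
    (hA : ∀ r c, c < r → PowerSeries.X ∣ A r c) :
    ∃ B : Matrix (Fin n) (Fin n) (PowerSeries ℂ), (∀ r, B r r = A r r) ∧
      ∀ c, (A.map toLaurent).mulVec (latticeCoord n m c) = latticeCoord n m (B.mulVec c) := by
  have h : ∀ r c, ∃ b, (r = c → b = A r c) ∧
      latticeScale m r * toLaurent b = toLaurent (A r c) * latticeScale m c := by
    intro r c
    unfold latticeScale
    by_cases hr : (r : ℕ) < m <;> by_cases hc : (c : ℕ) < m
    · exact ⟨A r c, fun _ => rfl, by rw [if_pos hr, if_pos hc, mul_comm]⟩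
    · refine ⟨PowerSeries.X * A r c, fun h => absurd (h ▸ hr) hc, ?_⟩
      rw [if_pos hr, if_neg hc, map_mul, algebraMap_X]
      simp
    · obtain ⟨b, hb⟩ := hA r c (Fin.lt_def.2 (by omega))
      refine ⟨b, fun h => absurd (h ▸ hc) hr, ?_⟩
      rw [if_neg hr, if_pos hc, hb, map_mul, algebraMap_X, mul_comm (tUnit : LaurentSeries ℂ), mul_assoc]
      simp
    · exact ⟨A r c, fun _ => rfl, by rw [if_neg hr, if_neg hc, mul_comm]⟩
  choose B hB hB' using h
  exact ⟨Matrix.of B, fun r => hB r r rfl, mulVec_latticeCoord hB'⟩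

theorem mem_translateLattice {n : ℕ} {g : GL (Fin n) (LaurentSeries ℂ)}
    {M : Submodule (PowerSeries ℂ) (Fin n → LaurentSeries ℂ)} {y : Fin n → LaurentSeries ℂ} :
    y ∈ translateLattice g M ↔ ∃ x ∈ M, g.1.mulVec x = y := Iff.rfl

theorem translateLattice_mul {n : ℕ} (g h : GL (Fin n) (LaurentSeries ℂ))
    (M : Submodule (PowerSeries ℂ) (Fin n → LaurentSeries ℂ)) :
    translateLattice (g * h) M = translateLattice g (translateLattice h M) := by
  ext y
  simp only [mem_translateLattice, exists_exists_and_eq_and, Matrix.mulVec_mulVec, Units.val_mul]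

theorem translateLattice_one {n : ℕ} (M : Submodule (PowerSeries ℂ) (Fin n → LaurentSeries ℂ)) :
    translateLattice 1 M = M := by
  ext y
  simp [mem_translateLattice]

theorem translateLattice_inv_eq {n : ℕ} {g : GL (Fin n) (LaurentSeries ℂ)}
    {M N : Submodule (PowerSeries ℂ) (Fin n → LaurentSeries ℂ)} (h : translateLattice g M = N) :
    translateLattice g⁻¹ N = M := by
  rw [← h, ← translateLattice_mul, inv_mul_cancel, translateLattice_one]

/-! ### The Iwahori subgroup as the stabilizer of the standard chain -/

/-- The group of matrices in `GL_n(ℂ[[t]])` that are upper triangular modulo `t`. -/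
def iwahoriGL (n : ℕ) : Subgroup (GL (Fin n) (PowerSeries ℂ)) :=
  (upperTriangular n).comap (Matrix.GeneralLinearGroup.map (PowerSeries.constantCoeff (R := ℂ)))

theorem mem_iwahoriGL {n : ℕ} {h : GL (Fin n) (PowerSeries ℂ)} :
    h ∈ iwahoriGL n ↔ ∀ r c, c < r → PowerSeries.X ∣ h.1 r c := by
  simp only [PowerSeries.X_dvd_iff]
  exact Iff.rfl

theorem mem_iwahori {n : ℕ} {p : PGL(n, LaurentSeries ℂ)} :
    p ∈ iwahori n ↔ ∃ h ∈ iwahoriGL n,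
      Matrix.ProjGenLinGroup.mk (Matrix.GeneralLinearGroup.map toLaurent h) = p := Iff.rfl

theorem mk_map_mem_iwahori {n : ℕ} {h : GL (Fin n) (PowerSeries ℂ)} (hh : h ∈ iwahoriGL n) :
    Matrix.ProjGenLinGroup.mk (Matrix.GeneralLinearGroup.map toLaurent h) ∈ iwahori n :=
  mem_iwahori.2 ⟨h, hh, rfl⟩

theorem mulVec_mem_stdLattice {n : ℕ} {h : GL (Fin n) (PowerSeries ℂ)} (hh : h ∈ iwahoriGL n) (m : ℕ)
    {y : Fin n → LaurentSeries ℂ} (hy : y ∈ stdLattice n m) :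
    (Matrix.GeneralLinearGroup.map toLaurent h).1.mulVec y ∈ stdLattice n m := by
  obtain ⟨c, rfl⟩ := hy
  obtain ⟨B, -, hB⟩ := exists_mulVec_latticeCoord m (mem_iwahoriGL.1 hh)
  exact ⟨_, (hB c).symm⟩

theorem exists_lift_of_mulVec_mem {n : ℕ} {g : Matrix (Fin n) (Fin n) (LaurentSeries ℂ)}
    (h : ∀ y ∈ stdLattice n 0, g.mulVec y ∈ stdLattice n 0) :
    ∃ a : Matrix (Fin n) (Fin n) (PowerSeries ℂ), a.map toLaurent = g := by
  have : ∀ r c, ∃ a, toLaurent a = g r c := by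
    intro r c
    obtain ⟨d, hd⟩ := h _ ⟨Pi.single c 1, rfl⟩
    refine ⟨d r, ?_⟩
    have e : latticeCoord n 0 (Pi.single c 1) = Pi.single c 1 := by
      funext j
      rw [latticeCoord_eq]
      by_cases hj : j = c
      · subst hj; simp [latticeScale]
      · simp [hj]
    rw [e, Matrix.mulVec_single_one] at hd
    have := congrFun hd r
    rw [latticeCoord_eq] at this
    simpa [latticeScale] using this
  choose a ha using this
  exact ⟨Matrix.of a, Matrix.ext ha⟩

/-- Stability of `λ_0` under `g` and `g⁻¹` makes both matrices integral. Stability of `λ_r` gives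
the triangularity of row `r` modulo `t`. -/
theorem mk_mem_iwahori {n : ℕ} [NeZero n] {g : GL (Fin n) (LaurentSeries ℂ)}
    (hg : ∀ i : Fin n, translateLattice g (stdLattice n i) = stdLattice n i) :
    Matrix.ProjGenLinGroup.mk g ∈ iwahori n := by
  obtain ⟨a, ha⟩ := exists_lift_of_mulVec_mem (g := g.1) fun y hy => by
    have := hg 0
    rw [Fin.val_zero] at this
    exact this.le (mem_translateLattice.2 ⟨y, hy, rfl⟩)
  obtain ⟨b, hb⟩ := exists_lift_of_mulVec_mem (g := g⁻¹.1) fun y hy => by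
    have := translateLattice_inv_eq (hg 0)
    rw [Fin.val_zero] at this
    exact this.le (mem_translateLattice.2 ⟨y, hy, rfl⟩)
  have hinj : Function.Injective fun M : Matrix (Fin n) (Fin n) (PowerSeries ℂ) => M.map toLaurent :=
    Matrix.map_injective toLaurent_injective
  have hab : a * b = 1 := hinj (by
    change (a * b).map toLaurent = (1 : Matrix (Fin n) (Fin n) (PowerSeries ℂ)).map toLaurent
    rw [Matrix.map_mul, ha, hb, Matrix.map_one _ (map_zero _) (map_one _), ← Units.val_mul, mul_inv_cancel, Units.val_one])
  refine mem_iwahori.2 ⟨⟨a, b, hab, mul_eq_one_comm.1 hab⟩, mem_iwahoriGL.2 fun r c hrc => ?_, ?_⟩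
  -- For `c < r` the vector `t⁻¹ e_c` lies in `λ_r`, and the vectors of `λ_r` have integral `r`-th
  -- coordinate; so `t⁻¹ g_{rc}` is integral.
  · obtain ⟨d, hd⟩ := (hg r).le (mem_translateLattice.2 ⟨_, ⟨Pi.single c 1, rfl⟩, rfl⟩)
    have e : latticeCoord n r (Pi.single c 1) =
        Pi.single c ((tUnit⁻¹ : (LaurentSeries ℂ)ˣ) : LaurentSeries ℂ) := by
      funext j
      rw [latticeCoord_eq]
      by_cases hj : j = c
      · subst hj; simp [latticeScale, Fin.lt_def.1 hrc]
      · simp [hj]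
    have h1 := congrFun hd r
    rw [e, latticeCoord_eq, Matrix.mulVec_single] at h1
    simp only [latticeScale, lt_irrefl, if_false, Units.val_one, one_mul, op_smul_eq_smul,
      Pi.smul_apply, Matrix.col_apply, smul_eq_mul] at h1
    refine ⟨d r, toLaurent_injective ?_⟩
    rw [map_mul, h1, algebraMap_X, Units.mul_inv_cancel_left, ← ha]
    rfl
  · congr 1
    exact Units.ext ha

/-- The matrix chosen in `toFl` and `g` carry the standard chain to the same chain, so their
quotient stabilizes it. This frees later arguments from the choice. -/
theorem toFl_eq {n : ℕ} [NeZero n] (q : GrBar.special n) {g : GL (Fin n) (LaurentSeries ℂ)}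
    (hg : ∀ i : Fin n, translateLattice g (stdLattice n i) = lineLattice i (q.1.L i)) :
    toFl q = QuotientGroup.mk (Matrix.ProjGenLinGroup.mk g) := by
  have h0 := (exists_latticeChain q.1 q.2).choose_spec
  refine QuotientGroup.eq.2 ?_
  rw [← map_inv, ← map_mul]
  refine mk_mem_iwahori fun i => ?_
  rw [translateLattice_mul, hg]
  exact translateLattice_inv_eq (h0 i)

/-! ### Iwahori matrices with prescribed reductions -/

/-- `r ≤ c` in the cyclic order starting at `m`. -/
abbrev CycLE {n : ℕ} (m r c : Fin n) : Prop :=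
  (m ≤ r ∧ r ≤ c) ∨ (r ≤ c ∧ c < m) ∨ (c < m ∧ m ≤ r)

/-- The matrix over `ℂ[[t]]` by which `iwahoriMat β 0` acts in the basis of `λ_m`. -/
def iwahoriMat {n : ℕ} (β : Matrix (Fin n) (Fin n) ℂ) (m : Fin n) :
    Matrix (Fin n) (Fin n) (PowerSeries ℂ) :=
  Matrix.of fun r c => (if CycLE m r c then 1 else PowerSeries.X) * PowerSeries.C (β r c)

/-- The part of `β` that is upper triangular in the cyclic order starting at `m`. -/
def cycUpper {n : ℕ} (β : Matrix (Fin n) (Fin n) ℂ) (m : Fin n) : Matrix (Fin n) (Fin n) ℂ :=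
  Matrix.of fun r c => if CycLE m r c then β r c else 0

theorem constantCoeff_iwahoriMat {n : ℕ} (β : Matrix (Fin n) (Fin n) ℂ) (m : Fin n) :
    (iwahoriMat β m).map PowerSeries.constantCoeff = cycUpper β m := by
  ext r c
  simp only [iwahoriMat, cycUpper, Matrix.map_apply, Matrix.of_apply]
  split_ifs <;> simp

/-- Rotating the indices by `m` turns the cyclic order starting at `m` into the usual one, and the
matrix into an upper triangular one. -/
theorem det_cycUpper {n : ℕ} [NeZero n] (β : Matrix (Fin n) (Fin n) ℂ) (m : Fin n) :
    (cycUpper β m).det = ∏ i, β i i := by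
  rw [← Matrix.det_submatrix_equiv_self (Equiv.addRight m), Matrix.det_of_isUpperTriangular]
  · refine (Finset.prod_congr rfl fun i _ => ?_).trans
      (Equiv.prod_comp (Equiv.addRight m) fun i => β i i)
    simp only [cycUpper, Matrix.submatrix_apply, Matrix.of_apply]
    rw [if_pos]
    rcases le_or_gt m (Equiv.addRight m i) with h | h
    · exact Or.inl ⟨h, le_rfl⟩
    · exact Or.inr (Or.inl ⟨le_rfl, h⟩)
  · intro r c hrc
    simp only [cycUpper, Matrix.submatrix_apply, Matrix.of_apply, Equiv.coe_addRight]
    rw [if_neg]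
    have h1 : ((r + m : Fin n) : ℕ) = if (r : ℕ) + m < n then (r : ℕ) + m else r + m - n := by
      rw [Fin.val_add]; split_ifs with h
      · exact Nat.mod_eq_of_lt h
      · rw [Nat.mod_eq_sub_mod (by omega), Nat.mod_eq_of_lt (by omega)]
    have h2 : ((c + m : Fin n) : ℕ) = if (c : ℕ) + m < n then (c : ℕ) + m else c + m - n := by
      rw [Fin.val_add]; split_ifs with h
      · exact Nat.mod_eq_of_lt h
      · rw [Nat.mod_eq_sub_mod (by omega), Nat.mod_eq_of_lt (by omega)]
    have h3 := Fin.lt_def.1 hrc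
    simp only [id] at h3
    unfold CycLE
    simp only [Fin.le_def, Fin.lt_def, h1, h2]
    split_ifs <;> omega

theorem isUnit_det_cycUpper {n : ℕ} [NeZero n] {β : Matrix (Fin n) (Fin n) ℂ} (hβ : ∀ i, β i i ≠ 0)
    (m : Fin n) : IsUnit (cycUpper β m).det := by
  rw [det_cycUpper, isUnit_iff_ne_zero]
  exact Finset.prod_ne_zero_iff.2 fun i _ => hβ i

theorem isUnit_det_iwahoriMat {n : ℕ} [NeZero n] {β : Matrix (Fin n) (Fin n) ℂ}
    (hβ : ∀ i, β i i ≠ 0) (m : Fin n) : IsUnit (iwahoriMat β m).det := by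
  rw [PowerSeries.isUnit_iff_constantCoeff, RingHom.map_det, RingHom.mapMatrix_apply,
    constantCoeff_iwahoriMat]
  exact isUnit_det_cycUpper hβ m

/-- The change of basis to `λ_m` gains a `t` where `r < m ≤ c` and loses one where `c < m ≤ r`. This
is exactly how the order starting at 0 differs from the cyclic order starting at `m`. -/
theorem iwahoriMat_mulVec_latticeCoord {n : ℕ} [NeZero n] (β : Matrix (Fin n) (Fin n) ℂ) (m : Fin n)
    (c : Fin n → PowerSeries ℂ) :
    ((iwahoriMat β 0).map toLaurent).mulVec (latticeCoord n m c) =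
      latticeCoord n m ((iwahoriMat β m).mulVec c) := by
  refine mulVec_latticeCoord (fun r c => ?_) c
  simp only [iwahoriMat, Matrix.of_apply, latticeScale, CycLE, Fin.le_def, Fin.lt_def, Fin.val_zero,
    map_mul]
  split_ifs <;> first | omega | simp [-LaurentSeries.coe_algebraMap, algebraMap_X, mul_comm]

/-- The element of `GL_n(ℂ[[t]])` with matrix `iwahoriMat β 0`. -/
def iwahoriElt {n : ℕ} [NeZero n] (β : Matrix (Fin n) (Fin n) ℂ) (hβ : ∀ i, β i i ≠ 0) :
    GL (Fin n) (PowerSeries ℂ) :=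
  Matrix.nonsingInvUnit (iwahoriMat β 0) (isUnit_det_iwahoriMat hβ 0)

theorem iwahoriElt_mem {n : ℕ} [NeZero n] (β : Matrix (Fin n) (Fin n) ℂ) (hβ : ∀ i, β i i ≠ 0) :
    iwahoriElt β hβ ∈ iwahoriGL n := by
  refine mem_iwahoriGL.2 fun r c hrc => ?_
  change PowerSeries.X ∣ iwahoriMat β 0 r c
  simp only [iwahoriMat, Matrix.of_apply]
  rw [if_neg]
  · exact dvd_mul_right _ _
  · unfold CycLE
    simp only [Fin.le_def, Fin.lt_def, Fin.val_zero] at hrc ⊢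
    omega

/-- In the basis of `λ_m` the matrix is invertible over `ℂ[[t]]` with reduction `cycUpper β m`, so
it acts on the lines of `λ_m / t λ_m` by that reduction. -/
theorem translateLattice_iwahoriElt {n : ℕ} [NeZero n] {β : Matrix (Fin n) (Fin n) ℂ}
    (hβ : ∀ i, β i i ≠ 0) (m : Fin n) {v : Fin n → ℂ} (hv : v ≠ 0)
    {l : ℙ ℂ (Fin n → ℂ)} (hl : (cycUpper β m).mulVec v ∈ l.submodule) :
    translateLattice (Matrix.GeneralLinearGroup.map toLaurent (iwahoriElt β hβ))
      (lineLattice m (Projectivization.mk ℂ v hv)) = lineLattice m l := by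
  have hcst : ∀ c : Fin n → PowerSeries ℂ, (fun j => PowerSeries.constantCoeff ((iwahoriMat β m).mulVec c j)) =
      (cycUpper β m).mulVec fun j => PowerSeries.constantCoeff (c j) := by
    intro c
    rw [← constantCoeff_iwahoriMat]
    funext j
    exact RingHom.map_mulVec _ _ _ _
  have hinj : Function.Injective (cycUpper β m).mulVec :=
    Matrix.mulVec_injective_iff_isUnit.2 ((Matrix.isUnit_iff_isUnit_det _).2 (isUnit_det_cycUpper hβ m))
  have hl' : ∀ w, w ∈ l.submodule ↔ ∃ s : ℂ, w = s • (cycUpper β m).mulVec v := by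
    obtain ⟨a, ha⟩ := mem_submodule_iff.1 hl
    have ha0 : a ≠ 0 := by
      rintro rfl
      rw [zero_smul] at ha
      exact hv (hinj (by rw [← ha, Matrix.mulVec_zero]))
    intro w
    rw [mem_submodule_iff]
    constructor
    · rintro ⟨s, rfl⟩
      exact ⟨s * a⁻¹, by rw [← ha, smul_smul, mul_assoc, inv_mul_cancel₀ ha0, mul_one]⟩
    · rintro ⟨s, rfl⟩
      exact ⟨s * a, by rw [← ha, smul_smul]⟩
  ext y
  constructor
  · rintro ⟨_, ⟨c, hc, rfl⟩, rfl⟩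
    refine ⟨(iwahoriMat β m).mulVec c, ?_, (iwahoriMat_mulVec_latticeCoord β m c).symm⟩
    obtain ⟨s, hs⟩ := mem_mk_submodule.1 (mem_reducesTo.1 hc)
    rw [SetLike.mem_coe, mem_reducesTo, hcst, hl', ← hs, Matrix.mulVec_smul]
    exact ⟨s, rfl⟩
  · rintro ⟨c, hc, rfl⟩
    rw [SetLike.mem_coe, mem_reducesTo, hl'] at hc
    obtain ⟨s, hs⟩ := hc
    have e : (iwahoriMat β m).mulVec ((iwahoriMat β m)⁻¹.mulVec c) = c := by
      rw [Matrix.mulVec_mulVec, Matrix.mul_nonsing_inv _ (isUnit_det_iwahoriMat hβ m), Matrix.one_mulVec]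
    refine ⟨_, ⟨(iwahoriMat β m)⁻¹.mulVec c, ?_, rfl⟩, ?_⟩
    · rw [SetLike.mem_coe, mem_reducesTo, mem_mk_submodule]
      refine ⟨s, hinj ?_⟩
      rw [← hcst, e, hs, Matrix.mulVec_smul]
    · refine (iwahoriMat_mulVec_latticeCoord β m _).trans ?_
      rw [e]

/-! ### The periodic basis vectors -/

/-- The vectors `e_k`, for `k ∈ ℤ`, with `e_{k + n} = t⁻¹ e_k`. -/
def periodicVec (n : ℕ) (k : ℤ) : Fin n → LaurentSeries ℂ := fun j =>
  if (n : ℤ) ∣ k - j then ((tUnit ^ (-((k - j) / n)) : (LaurentSeries ℂ)ˣ) : LaurentSeries ℂ) else 0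

theorem dvd_iff_eq_zero {n : ℕ} {a : ℤ} (h1 : -(n : ℤ) < a) (h2 : a < n) : (n : ℤ) ∣ a ↔ a = 0 :=
  ⟨fun h => Int.eq_zero_of_abs_lt_dvd h (abs_lt.2 ⟨h1, h2⟩), fun h => h ▸ dvd_zero _⟩

theorem exists_residue (n : ℕ) [NeZero n] (k : ℤ) : ∃ (j : Fin n) (s : ℤ), k = j + s * n := by
  have hn : (0 : ℤ) < n := by exact_mod_cast Nat.pos_of_ne_zero (NeZero.ne n)
  have h1 := Int.emod_nonneg k hn.ne'
  have h2 := Int.emod_lt_of_pos k hn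
  refine ⟨⟨(k % n).toNat, by omega⟩, k / n, ?_⟩
  simp only [Int.toNat_of_nonneg h1]
  rw [mul_comm]
  exact (Int.emod_add_mul_ediv k n).symm

theorem periodicVec_add_mul {n : ℕ} (k s : ℤ) :
    periodicVec n (k + s * n) = ((tUnit ^ (-s) : (LaurentSeries ℂ)ˣ) : LaurentSeries ℂ) • periodicVec n k := by
  funext j
  have hn : (n : ℤ) ≠ 0 := by have := j.2; omega
  unfold periodicVec
  rw [Pi.smul_apply, smul_eq_mul, show k + s * n - j = k - j + s * n by ring]
  by_cases h : (n : ℤ) ∣ k - j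
  · rw [if_pos h, if_pos (dvd_add h (dvd_mul_left _ _)), Int.add_mul_ediv_right _ _ hn, ← Units.val_mul,
      ← zpow_add]
    congr 2
    ring
  · rw [if_neg h, if_neg (fun h' => h ((Int.dvd_add_left (dvd_mul_left _ _)).1 h')), mul_zero]

theorem periodicVec_coe {n : ℕ} (j : Fin n) : periodicVec n j = Pi.single j 1 := by
  funext i
  unfold periodicVec
  have hi := i.2
  have hj := j.2
  by_cases h : i = j
  · subst h; simp
  · have : (i : ℕ) ≠ j := fun h' => h (Fin.ext h')
    rw [if_neg, Pi.single_eq_of_ne h]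
    rw [dvd_iff_eq_zero (by omega) (by omega)]
    omega

/-- The index in `{m, …, m + n - 1}` that is congruent to `j`. -/
def topIdx {n : ℕ} (m j : Fin n) : ℤ := j + if (j : ℕ) < m then (n : ℤ) else 0

theorem X_pow_smul_periodicVec {n : ℕ} (a : ℕ) (k : ℤ) :
    (PowerSeries.X ^ a : PowerSeries ℂ) • periodicVec n k = periodicVec n (k - a * n) := by
  rw [sub_eq_add_neg, ← neg_mul, periodicVec_add_mul]
  funext j
  rw [Pi.smul_apply, Algebra.smul_def, map_pow, algebraMap_X]
  simp

theorem latticeCoord_single {n : ℕ} (m j : Fin n) (a : PowerSeries ℂ) :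
    latticeCoord n m (Pi.single j a) = a • periodicVec n (topIdx m j) := by
  funext i
  have h : periodicVec n (topIdx m j) = (latticeScale m j : LaurentSeries ℂ) • periodicVec n j := by
    unfold topIdx latticeScale
    split_ifs
    · have := periodicVec_add_mul (n := n) j 1
      rwa [one_mul, zpow_neg_one] at this
    · simp
  rw [h, periodicVec_coe, latticeCoord_eq, Pi.smul_apply, Pi.smul_apply, Algebra.smul_def]
  by_cases hi : i = j
  · subst hi
    simp only [Pi.single_eq_same, smul_eq_mul, mul_one]
    rw [mul_comm]
  · simp [hi]

theorem latticeCoord_eq_sum {n : ℕ} (m : Fin n) (c : Fin n → PowerSeries ℂ) :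
    latticeCoord n m c = ∑ j, c j • periodicVec n (topIdx m j) := by
  conv_lhs => rw [← Finset.univ_sum_single c]
  rw [map_sum]
  exact Finset.sum_congr rfl fun j _ => latticeCoord_single m j _

theorem topIdx_bounds {n : ℕ} (m j : Fin n) : (m : ℤ) ≤ topIdx m j ∧ topIdx m j < m + n := by
  have := m.2
  have := j.2
  unfold topIdx
  split_ifs <;> omega

theorem exists_topIdx {n : ℕ} [NeZero n] (m : Fin n) (k : ℤ) :
    ∃ (j : Fin n) (s : ℤ), k = topIdx m j - s * n := by
  obtain ⟨j, s, rfl⟩ := exists_residue n k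
  by_cases h : (j : ℕ) < m
  · exact ⟨j, 1 - s, by rw [topIdx, if_pos h]; ring⟩
  · exact ⟨j, -s, by rw [topIdx, if_neg h]; ring⟩

theorem exists_topIdx_nat {n : ℕ} [NeZero n] {m : Fin n} {k : ℤ} (hk : k < m + n) :
    ∃ (j : Fin n) (s : ℕ), k = topIdx m j - s * n := by
  obtain ⟨j, s, rfl⟩ := exists_topIdx m k
  refine ⟨j, s.toNat, ?_⟩
  rw [Int.toNat_of_nonneg]
  have := (topIdx_bounds m j).1
  by_contra! h
  nlinarith [show (0 : ℤ) ≤ n from Int.natCast_nonneg n]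

/-- The basis of `λ_m` consists of the `e_k` with `m ≤ k < m + n`, and multiplication by `t` lowers
`k` by `n`. Lattices thus become sets of integers, on which `W_ext` acts by permutations. -/
theorem stdLattice_eq_span {n : ℕ} [NeZero n] (m : Fin n) :
    stdLattice n m = Submodule.span (PowerSeries ℂ) (periodicVec n '' {k | k < m + n}) := by
  apply le_antisymm
  · rintro _ ⟨c, rfl⟩
    rw [latticeCoord_eq_sum]
    exact Submodule.sum_mem _ fun j _ => Submodule.smul_mem _ _
      (Submodule.subset_span ⟨_, (topIdx_bounds m j).2, rfl⟩)
  · rw [Submodule.span_le]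
    rintro _ ⟨k, hk, rfl⟩
    obtain ⟨j, s, rfl⟩ := exists_topIdx_nat hk
    exact ⟨Pi.single j (PowerSeries.X ^ s), by rw [latticeCoord_single, X_pow_smul_periodicVec]⟩

theorem single_one_ne_zero {n : ℕ} (j : Fin n) : (Pi.single j 1 : Fin n → ℂ) ≠ 0 :=
  fun h => one_ne_zero (α := ℂ) (by simpa using congrFun h j)

/-- The coordinate line spanned by `e_j`. -/
abbrev coordLine {n : ℕ} (j : Fin n) : ℙ ℂ (Fin n → ℂ) :=
  Projectivization.mk ℂ (Pi.single j 1) (single_one_ne_zero j)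

/-- The vectors `e_k` with `k < m` span `t λ_m`; the preimage of a coordinate line needs only one
further generator. -/
theorem lineLattice_coordLine {n : ℕ} [NeZero n] (m j : Fin n) :
    lineLattice m (coordLine j) =
      Submodule.span (PowerSeries ℂ) (periodicVec n '' {k | k < m ∨ k = topIdx m j}) := by
  apply le_antisymm
  · rintro _ ⟨c, hc, rfl⟩
    obtain ⟨s, hs⟩ := mem_mk_submodule.1 (mem_reducesTo.1 hc)
    rw [latticeCoord_eq_sum]
    refine Submodule.sum_mem _ fun i _ => ?_
    by_cases hi : i = j
    · exact Submodule.smul_mem _ _ (Submodule.subset_span ⟨_, Or.inr rfl, by rw [hi]⟩)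
    · have := congrFun hs i
      simp only [Pi.smul_apply, Pi.single_eq_of_ne hi, smul_zero] at this
      obtain ⟨d, hd⟩ := PowerSeries.X_dvd_iff.2 this.symm
      have e := X_pow_smul_periodicVec (n := n) 1 (topIdx m i)
      rw [pow_one] at e
      rw [hd, mul_comm, mul_smul, e]
      refine Submodule.smul_mem _ _ (Submodule.subset_span ⟨_, Or.inl ?_, rfl⟩)
      have := (topIdx_bounds m i).2
      push_cast
      omega
  · rw [Submodule.span_le]
    rintro _ ⟨k, hk | rfl, rfl⟩
    -- Shifting `k` by `n` before taking the residue makes the exponent of `t` at least 1, so the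
    -- vector reduces to zero.
    · obtain ⟨i, s, hs⟩ := exists_topIdx_nat (m := m) (k := k + n) (by omega)
      obtain rfl : k = topIdx m i - (s + 1 : ℕ) * n := by push_cast; linarith
      refine ⟨Pi.single i (PowerSeries.X ^ (s + 1)), ?_, by
        rw [latticeCoord_single, X_pow_smul_periodicVec]⟩
      rw [SetLike.mem_coe, mem_reducesTo]
      convert Submodule.zero_mem _
      rename_i i'
      by_cases h : i' = i
      · subst h; simp
      · simp [h]
    · refine ⟨Pi.single j 1, ?_, by rw [latticeCoord_single, one_smul]⟩
      rw [SetLike.mem_coe, mem_reducesTo, mem_mk_submodule]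
      refine ⟨1, funext fun i => ?_⟩
      by_cases h : i = j
      · subst h; simp
      · simp [h]

/-! ### The extended affine Weyl group as permutations of `ℤ` -/

/-- `p ∈ PGL_n(ℂ((t)))` is represented by a matrix with `e_k ↦ e_{σ k}` for all `k ∈ ℤ`. -/
def IsMonomial {n : ℕ} (p : PGL(n, LaurentSeries ℂ)) (σ : ℤ → ℤ) : Prop :=
  ∃ g : GL (Fin n) (LaurentSeries ℂ), Matrix.ProjGenLinGroup.mk g = p ∧
    ∀ k, g.1.mulVec (periodicVec n k) = periodicVec n (σ k)

theorem IsMonomial.one {n : ℕ} : IsMonomial (1 : PGL(n, LaurentSeries ℂ)) id :=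
  ⟨1, map_one _, fun k => by simp⟩

theorem IsMonomial.mul {n : ℕ} {p q : PGL(n, LaurentSeries ℂ)} {σ τ : ℤ → ℤ} (hp : IsMonomial p σ)
    (hq : IsMonomial q τ) : IsMonomial (p * q) (σ ∘ τ) := by
  obtain ⟨g, rfl, hg⟩ := hp
  obtain ⟨h, rfl, hh⟩ := hq
  refine ⟨g * h, map_mul _ _ _, fun k => ?_⟩
  rw [Units.val_mul, ← Matrix.mulVec_mulVec, hh, hg, Function.comp_apply]

theorem permGL_mulVec {n : ℕ} (σ : Equiv.Perm (Fin n)) (v : Fin n → LaurentSeries ℂ) (j : Fin n) :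
    (permGL n (LaurentSeries ℂ) σ).1.mulVec v j = v (σ.symm j) := by
  change (Matrix.of fun i j => if i = σ j then (1 : LaurentSeries ℂ) else 0).mulVec v j = _
  simp only [Matrix.mulVec, dotProduct, Matrix.of_apply, ite_mul, one_mul, zero_mul]
  rw [Finset.sum_eq_single (σ.symm j)]
  · simp
  · intro b _ hb
    rw [if_neg]
    rintro rfl
    simp at hb
  · simp

theorem isMonomial_perm {n : ℕ} {σ : Equiv.Perm (Fin n)} {τ : ℤ → ℤ}
    (h : ∀ k j, periodicVec n k (σ.symm j) = periodicVec n (τ k) j) :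
    IsMonomial (wRep n (SemidirectProduct.inr σ)) τ := by
  refine ⟨permGL n (LaurentSeries ℂ) σ, ?_, fun k => funext fun j => ?_⟩
  · unfold wRep
    rw [SemidirectProduct.lift_inr]
    rfl
  · rw [permGL_mulVec, h]

theorem isMonomial_transl {n : ℕ} {v : Fin n → ℤ} {τ : ℤ → ℤ}
    (h : ∀ k (j : Fin n), (n : ℤ) ∣ k - j → τ k = k + v j * n) [NeZero n] :
    IsMonomial (wRep n (transl (QuotientAddGroup.mk v))) τ := by
  refine ⟨diagGL n (LaurentSeries ℂ) fun j => tUnit ^ (-(v j)), ?_, fun k => funext fun j => ?_⟩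
  · unfold wRep transl
    rw [SemidirectProduct.lift_inl]
    rfl
  · change (Matrix.diagonal fun j => ((tUnit ^ (-(v j)) : (LaurentSeries ℂ)ˣ) : LaurentSeries ℂ)).mulVec _ j = _
    rw [Matrix.mulVec_diagonal]
    by_cases hk : (n : ℤ) ∣ k - j
    · rw [h k j hk, periodicVec_add_mul]
      rfl
    · have : ¬ (n : ℤ) ∣ τ k - j := by
        obtain ⟨i, s, hi⟩ := exists_residue n k
        rw [h k i ⟨s, by rw [hi]; ring⟩]
        intro h'
        refine hk ((Int.dvd_add_left (dvd_mul_left (n : ℤ) (v i))).1 ?_)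
        convert h' using 1
        ring
      unfold periodicVec
      rw [if_neg hk, if_neg this, mul_zero]

/-- The simple reflection that exchanges `i + s n` and `i + 1 + s n` for all `s`. -/
def affineSwap (n : ℕ) (i k : ℤ) : ℤ :=
  if (n : ℤ) ∣ k - i then k + 1 else if (n : ℤ) ∣ k - i - 1 then k - 1 else k

theorem not_dvd_of_dvd_add_one {n : ℕ} (hn : 2 ≤ n) {a : ℤ} (h : (n : ℤ) ∣ a) : ¬ (n : ℤ) ∣ a + 1 := by
  intro h'
  have := (Int.dvd_add_right h).1 h'
  have := Int.le_of_dvd one_pos this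
  omega

theorem affineSwap_involutive {n : ℕ} (hn : 2 ≤ n) (i : ℤ) : Function.Involutive (affineSwap n i) := by
  intro k
  unfold affineSwap
  by_cases h1 : (n : ℤ) ∣ k - i
  · have h2 := not_dvd_of_dvd_add_one hn h1
    rw [if_pos h1, if_neg (by rwa [show k + 1 - i = k - i + 1 by ring]),
      if_pos (by rwa [show k + 1 - i - 1 = k - i by ring])]
    ring
  · by_cases h2 : (n : ℤ) ∣ k - i - 1
    · rw [if_neg h1, if_pos h2, if_pos (by rwa [show k - 1 - i = k - i - 1 by ring])]
      ring
    · rw [if_neg h1, if_neg h2, if_neg h1, if_neg h2]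

theorem affineSwap_add_mul {n : ℕ} (i k s : ℤ) :
    affineSwap n i (k + s * n) = affineSwap n i k + s * n := by
  unfold affineSwap
  have h1 : (n : ℤ) ∣ k + s * n - i ↔ (n : ℤ) ∣ k - i := by
    rw [show k + s * n - i = k - i + s * n by ring]
    exact Int.dvd_add_left (dvd_mul_left _ _)
  have h2 : (n : ℤ) ∣ k + s * n - i - 1 ↔ (n : ℤ) ∣ k - i - 1 := by
    rw [show k + s * n - i - 1 = k - i - 1 + s * n by ring]
    exact Int.dvd_add_left (dvd_mul_left _ _)
  simp only [h1, h2]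
  split_ifs <;> ring

theorem affineSwap_of_mem_Ico {n : ℕ} {i k : ℤ} (hi : 0 ≤ i) (hi' : i + 1 < n) (hk : 0 ≤ k)
    (hk' : k < n) : affineSwap n i k = if k = i then k + 1 else if k = i + 1 then k - 1 else k := by
  unfold affineSwap
  simp only [dvd_iff_eq_zero (show -(n : ℤ) < k - i by omega) (by omega),
    dvd_iff_eq_zero (show -(n : ℤ) < k - i - 1 by omega) (by omega)]
  simp only [sub_sub, sub_eq_zero]

theorem periodicVec_add_mul_apply {n : ℕ} (k s : ℤ) (j : Fin n) : periodicVec n (k + s * n) j =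
    ((tUnit ^ (-s) : (LaurentSeries ℂ)ˣ) : LaurentSeries ℂ) * periodicVec n k j := by
  rw [periodicVec_add_mul]
  rfl

theorem isMonomial_swap {n : ℕ} [NeZero n] (i : Fin n) (hi : (i : ℕ) + 1 < n) :
    IsMonomial (wRep n (SemidirectProduct.inr (Equiv.swap i (i + 1)))) (affineSwap n i) := by
  refine isMonomial_perm fun k j => ?_
  obtain ⟨l, s, rfl⟩ := exists_residue n k
  have hs := fin_val_succ i
  rw [if_neg (by omega)] at hs
  obtain ⟨l', hl'⟩ : ∃ l' : Fin n, affineSwap n i l = l' ∧ Equiv.swap i (i + 1) l = l' := by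
    refine ⟨Equiv.swap i (i + 1) l, ?_, rfl⟩
    rw [affineSwap_of_mem_Ico (by omega) (by omega) (by omega) (by have := l.2; omega)]
    rw [Equiv.swap_apply_def]
    simp only [Fin.ext_iff]
    split_ifs <;> omega
  rw [affineSwap_add_mul, periodicVec_add_mul_apply, periodicVec_add_mul_apply, hl'.1,
    periodicVec_coe, periodicVec_coe, ← hl'.2]
  congr 1
  by_cases h : j = Equiv.swap i (i + 1) l
  · subst h; simp
  · rw [Pi.single_eq_of_ne h, Pi.single_eq_of_ne]
    intro h'
    exact h (by rw [← h']; simp)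

/-- The translation `τ` lowers the multiples of `n` by `n` and raises the residue `n - 1` by `n`;
then `ρ` exchanges these two residues inside each period. The composite exchanges `s n - 1` and `s
n`. -/
theorem isMonomial_swap_last {n : ℕ} [NeZero n] (hn : 2 ≤ n) (i : Fin n) (hi : (i : ℕ) = n - 1) :
    IsMonomial (wRep n (SemidirectProduct.inr (Equiv.swap 0 i) *
      transl (-(basisCoweight 0 - basisCoweight i)))) (affineSwap n i) := by
  let v : Fin n → ℤ := -(Pi.single 0 1 - Pi.single i 1)
  have hi0 : (i : ℕ) ≠ 0 := by omega
  have hi0' : i ≠ 0 := fun h => hi0 (by rw [h, Fin.val_zero])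
  let τ : ℤ → ℤ := fun k => if (n : ℤ) ∣ k then k - n else if (n : ℤ) ∣ k - i then k + n else k
  let ρ : ℤ → ℤ := fun k => if (n : ℤ) ∣ k then k + i else if (n : ℤ) ∣ k - i then k - i else k
  have hτ : IsMonomial (wRep n (transl (-(basisCoweight 0 - basisCoweight i)))) τ := by
    refine isMonomial_transl (v := v) fun k j hkj => ?_
    obtain ⟨s, hs⟩ := hkj
    obtain rfl : k = j + n * s := by omega
    have hj := j.2
    have h1 : (n : ℤ) ∣ j + n * s ↔ (j : ℤ) = 0 := by
      rw [Int.dvd_add_left (dvd_mul_right _ _), dvd_iff_eq_zero (by omega) (by omega)]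
    have h2 : (n : ℤ) ∣ j + n * s - i ↔ (j : ℤ) - i = 0 := by
      rw [show (j + n * s - i : ℤ) = j - i + n * s by ring,
        Int.dvd_add_left (dvd_mul_right _ _), dvd_iff_eq_zero (by omega) (by omega)]
    simp only [τ, h1, h2, v, Pi.neg_apply, Pi.sub_apply, Pi.single_apply, Fin.ext_iff, Fin.val_zero]
    split_ifs <;> omega
  have hρ : IsMonomial (wRep n (SemidirectProduct.inr (Equiv.swap 0 i))) ρ := by
    refine isMonomial_perm fun k j => ?_
    obtain ⟨l, s, rfl⟩ := exists_residue n k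
    have hl := l.2
    have h1 : (n : ℤ) ∣ l + s * n ↔ (l : ℤ) = 0 := by
      rw [Int.dvd_add_left (dvd_mul_left _ _), dvd_iff_eq_zero (by omega) (by omega)]
    have h2 : (n : ℤ) ∣ l + s * n - i ↔ (l : ℤ) - i = 0 := by
      rw [show (l + s * n - i : ℤ) = l - i + s * n by ring,
        Int.dvd_add_left (dvd_mul_left _ _), dvd_iff_eq_zero (by omega) (by omega)]
    have e : ρ (l + s * n) = (Equiv.swap 0 i l : Fin n) + s * n := by
      simp only [ρ, h1, h2]
      rw [Equiv.swap_apply_def]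
      simp only [Fin.ext_iff, Fin.val_zero]
      split_ifs <;> first | omega | (simp; omega)
    rw [e, periodicVec_add_mul_apply, periodicVec_add_mul_apply, periodicVec_coe, periodicVec_coe]
    congr 1
    by_cases h : j = Equiv.swap 0 i l
    · subst h; simp
    · rw [Pi.single_eq_of_ne h, Pi.single_eq_of_ne]
      intro h'
      exact h (by rw [← h']; simp)
  rw [map_mul]
  convert hρ.mul hτ using 1
  funext k
  obtain ⟨l, s, rfl⟩ := exists_residue n k
  have hl := l.2
  have key : ∀ a b : ℤ, -(n : ℤ) < a → a < n → ((n : ℤ) ∣ a + b * n ↔ a = 0) := fun a b h h' => by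
    rw [Int.dvd_add_left (dvd_mul_left _ _), dvd_iff_eq_zero h h']
  have h1 : (n : ℤ) ∣ l + s * n ↔ (l : ℤ) = 0 := key _ _ (by omega) (by omega)
  have h2 : (n : ℤ) ∣ l + s * n - i ↔ (l : ℤ) - i = 0 := by
    rw [← key (l - i) s (by omega) (by omega), show (l + s * n - i : ℤ) = l - i + s * n by ring]
  have h3 : (n : ℤ) ∣ l + s * n - i - 1 ↔ (l : ℤ) = 0 := by
    rw [← key l (s - 1) (by omega) (by omega)]
    rw [show (l + s * n - i - 1 : ℤ) = l + (s - 1) * n by rw [show (i : ℤ) = n - 1 by omega]; ring]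
  rw [Function.comp_apply]
  have e1 : affineSwap n i (l + s * n) = if (l : ℤ) - i = 0 then l + s * n + 1 else
      if (l : ℤ) = 0 then l + s * n - 1 else l + s * n := by
    simp only [affineSwap, h2, h3]
  have e2 : τ (l + s * n) = if (l : ℤ) = 0 then l + s * n - n else
      if (l : ℤ) - i = 0 then l + s * n + n else l + s * n := by
    simp only [τ, h1, h2]
  rw [e1, e2]
  by_cases hl0 : (l : ℤ) = 0
  · rw [if_neg (by omega), if_pos hl0, if_pos hl0]
    simp only [ρ]
    rw [if_pos (by rw [hl0]; exact ⟨s - 1, by ring⟩)]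
    omega
  · by_cases hli : (l : ℤ) - i = 0
    · rw [if_pos hli, if_neg hl0, if_pos hli]
      simp only [ρ]
      have : (l : ℤ) = i := by omega
      rw [this, if_neg, if_pos ⟨s + 1, by ring⟩]
      · omega
      · rw [show (i : ℤ) + s * n + n = i + (s + 1) * n by ring, key _ _ (by omega) (by omega)]
        omega
    · rw [if_neg hli, if_neg hl0, if_neg hl0, if_neg hli]
      simp only [ρ, h1, h2]
      rw [if_neg hl0, if_neg hli]

theorem isMonomial_simpleRefl {n : ℕ} [NeZero n] (hn : 2 ≤ n) (i : Fin n) :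
    IsMonomial (wRep n (simpleRefl i)) (affineSwap n i) := by
  unfold simpleRefl
  split_ifs with h
  · exact isMonomial_swap_last hn i h
  · exact isMonomial_swap i (by have := i.2; omega)

/-- The permutation of `ℤ` given by the word `s_{i_1} ⋯ s_{i_k}`. -/
def affineWord {n : ℕ} (l : List (Fin n)) (k : ℤ) : ℤ := l.foldr (fun i : Fin n => affineSwap n i) k

/-- The bound `2 ≤ n` is asked only of words with a letter, so that the empty word is available for
`n = 1`. -/
theorem isMonomial_wordProd {n : ℕ} [NeZero n] (l : List (Fin n)) (hl : ∀ i ∈ l, 2 ≤ n) :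
    IsMonomial (wRep n (wordProd l)) (affineWord l) := by
  induction l with
  | nil =>
    unfold wordProd
    rw [List.map_nil, List.prod_nil, map_one]
    exact IsMonomial.one
  | cons i l ih =>
    have : wordProd (i :: l) = simpleRefl i * wordProd l := by
      simp [wordProd]
    rw [this, map_mul]
    exact (isMonomial_simpleRefl (hl i (by simp)) i).mul (ih fun j hj => hl j (by simp [hj]))

theorem affineWord_add_mul {n : ℕ} (l : List (Fin n)) (k s : ℤ) :
    affineWord l (k + s * n) = affineWord l k + s * n := by
  induction l with
  | nil => rfl
  | cons i l ih =>
    change affineSwap n i (affineWord l (k + s * n)) = affineSwap n i (affineWord l k) + s * n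
    rw [ih, affineSwap_add_mul]

theorem foldr_affineSwap_range {n m : ℕ} (hm : m + 1 ≤ n) {k : ℤ} (hk : 0 ≤ k) (hk' : k < n) :
    (List.range m).foldr (fun i : ℕ => affineSwap n i) k =
      if k < m then k + 1 else if k = m then 0 else k := by
  induction m generalizing k with
  | zero =>
    simp only [List.range_zero, List.foldr_nil]
    split_ifs <;> omega
  | succ m ih =>
    rw [List.range_succ, List.foldr_append, List.foldr_cons, List.foldr_nil,
      affineSwap_of_mem_Ico (by omega) (by omega) hk hk', ih (by omega) (by split_ifs <;> omega)
        (by split_ifs <;> omega)]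
    split_ifs <;> omega

/-- The translation acts first and raises the residue `n - 1` by `n`. The word is the cycle `0 → 1 →
⋯ → n - 1 → 0` inside each period, and the raise turns its return to 0 into a step by one. -/
theorem isMonomial_omega (n : ℕ) [NeZero n] : IsMonomial (wRep n (omega n)) (fun k => k + 1) := by
  have hn : 0 < n := Nat.pos_of_ne_zero (NeZero.ne n)
  have hlast : ((-1 : Fin n) : ℤ) = n - 1 := by
    have := fin_val_sub_one (0 : Fin n)
    rwa [Fin.val_zero, if_pos rfl, zero_sub] at this
  let τ : ℤ → ℤ := fun k => if (n : ℤ) ∣ k + 1 then k + n else k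
  have hτ : IsMonomial (wRep n (transl (basisCoweight (-1)))) τ := by
    refine isMonomial_transl (v := Pi.single (-1) 1) fun k j hkj => ?_
    obtain ⟨s, hs⟩ := hkj
    obtain rfl : k = j + n * s := by omega
    have hj := j.2
    have h : (n : ℤ) ∣ j + n * s + 1 ↔ j = -1 := by
      rw [show (j + n * s + 1 : ℤ) = j - (n - 1) + n * (s + 1) by ring,
        Int.dvd_add_left (dvd_mul_right _ _), dvd_iff_eq_zero (by omega) (by omega), Fin.ext_iff]
      omega
    simp only [τ, h, Pi.single_apply]
    split_ifs <;> simp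
  have hw := isMonomial_wordProd (n := n) (List.finRange n).dropLast (by
    intro i hi
    have := List.length_pos_of_mem hi
    rw [List.length_dropLast, List.length_finRange] at this
    omega)
  unfold omega
  rw [map_mul]
  convert hw.mul hτ using 1
  funext k
  have hr : ∀ a, affineWord (List.finRange n).dropLast a =
      (List.range (n - 1)).foldr (fun i : ℕ => affineSwap n i) a := by
    intro a
    have : (List.range (n - 1)) = (List.finRange n).dropLast.map Fin.val := by
      rw [List.map_dropLast, List.map_coe_finRange_eq_range]
      obtain ⟨m, rfl⟩ := Nat.exists_eq_succ_of_ne_zero hn.ne'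
      rw [Nat.succ_eq_add_one, List.range_succ, Nat.add_sub_cancel, List.dropLast_concat]
    rw [this, List.foldr_map]
    rfl
  obtain ⟨l, s, rfl⟩ := exists_residue n k
  have hl := l.2
  have h : (n : ℤ) ∣ l + s * n + 1 ↔ (l : ℤ) - (n - 1) = 0 := by
    rw [show (l + s * n + 1 : ℤ) = l - (n - 1) + (s + 1) * n by ring,
      Int.dvd_add_left (dvd_mul_left _ _), dvd_iff_eq_zero (by omega) (by omega)]
  rw [Function.comp_apply]
  simp only [τ, h]
  by_cases h' : (l : ℤ) - (n - 1) = 0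
  · rw [if_pos h', show (l + s * n + n : ℤ) = l + (s + 1) * n by ring, affineWord_add_mul, hr,
      foldr_affineSwap_range (by omega) (by omega) (by omega), if_neg (by omega), if_pos (by omega),
      show (l : ℤ) = n - 1 by omega]
    ring
  · rw [if_neg h', affineWord_add_mul, hr,
      foldr_affineSwap_range (by omega) (by omega) (by omega), if_pos (by omega)]
    ring

/-! ### The elements `w_I` as permutations of `ℤ` -/

/-- In an acceptable order, the cyclic successor of an element stands before this element. -/
theorem IsAcceptableOrder.pairwise {n : ℕ} [NeZero n] {I : Finset (Fin n)} {l : List (Fin n)}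
    (h : IsAcceptableOrder I l) : l.Pairwise fun a b => b ≠ a + 1 := by
  obtain ⟨hnd, hmem, hhead, huniq⟩ := h
  rw [List.pairwise_iff_getElem]
  intro q p hq hp hqp hval
  have hk : 0 < l.length := by omega
  have hne : l ≠ [] := List.length_pos_iff.1 hk
  have hq0 : q ≠ 0 := by
    rintro rfl
    refine hhead l[0] (by rw [List.head?_eq_getElem?, List.getElem?_eq_getElem hk]; rfl) ?_
    rw [← hval]
    exact (hmem _).1 (List.getElem_mem _)
  obtain ⟨m, -, hm⟩ := huniq hne
  have hfail : ∀ x (hx : x < l.length), x ≠ m →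
      l[(x + 1) % l.length]'(Nat.mod_lt _ hk) < l[x] := by
    intro x hx hxm
    by_contra hx'
    exact hxm (congrArg Fin.val (hm ⟨x, hx⟩ hx'))
  have hstep : ∀ x (hx : x + 1 < l.length), x ≠ m → l[x + 1] < l[x] := by
    intro x hx hxm
    have := hfail x (by omega) hxm
    simpa only [Nat.mod_eq_of_lt hx] using this
  have hchain : ∀ d x (hx : x + d < l.length), (∀ y, x ≤ y → y < x + d → y ≠ m) →
      l[x + d] ≤ l[x] := by
    intro d
    induction d with
    | zero => intro x hx _; exact le_rfl
    | succ d ih =>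
      intro x hx hy
      exact (hstep (x + d) hx (hy _ (by omega) (by omega))).le.trans
        (ih x (by omega) fun y h1 h2 => hy y h1 (by omega))
  have hchain' : ∀ x y (hx : x < l.length) (hy : y < l.length), x ≤ y →
      (∀ z, x ≤ z → z < y → z ≠ m) → l[y] ≤ l[x] := by
    intro x y hx hy hxy hz
    obtain ⟨d, rfl⟩ := Nat.exists_eq_add_of_le hxy
    exact hchain d x hy hz
  have hs := fin_val_succ l[q]
  rw [← hval] at hs
  have hlp := l[p].2
  split_ifs at hs with hlast
  -- Wrap-around case: `l[q]` is the largest index and `l[p]` the smallest. The descent then fails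
  -- at `p`, so it holds just before `q`, where it would require an entry larger than `l[q]`.
  · have hpm : p = m := by
      by_contra hpm
      have := Fin.lt_def.1 (hfail p hp hpm)
      omega
    obtain ⟨q', rfl⟩ := Nat.exists_eq_succ_of_ne_zero hq0
    have := Fin.lt_def.1 (hstep q' hq (by omega))
    have := l[q'].2
    simp only [Nat.succ_eq_add_one] at *
    omega
  -- Since `l[q] < l[p]`, the unique failure lies between `q` and `p`. Hence the descent from `p` to
  -- the end and around to `q` is unbroken: `l[p] ≥ l[last] > l[0] ≥ l[q]`. As `l[p] = l[q] + 1`,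
  -- this forces `l[0] = l[q]`, against `q ≠ 0`.
  · have hm1 : q ≤ m ∧ (m : ℕ) < p := by
      by_contra hm1
      have := Fin.le_def.1 (hchain' q p hq hp hqp.le fun z h1 h2 hz => hm1 (by omega))
      omega
    have h1 := Fin.le_def.1 (hchain' p (l.length - 1) hp (by omega) (by omega) fun z h1 h2 hz => by omega)
    have h2 := Fin.lt_def.1 (hfail (l.length - 1) (by omega) (by omega))
    simp only [show (l.length - 1 + 1) % l.length = 0 by
      rw [Nat.sub_add_cancel hk, Nat.mod_self]] at h2
    have h3 := Fin.le_def.1 (hchain' 0 q hk hq (by omega) fun z h1 h2 hz => by omega)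
    have h4 : l[0] = l[q] := Fin.ext (by omega)
    have := (List.Nodup.getElem_inj_iff hnd).1 h4
    omega

/-- `k` is congruent to an element of the list. -/
def InList {n : ℕ} (l : List (Fin n)) (k : ℤ) : Prop := ∃ i ∈ l, (n : ℤ) ∣ k - i

theorem inList_cons {n : ℕ} {i : Fin n} {l : List (Fin n)} {k : ℤ} :
    InList (i :: l) k ↔ (n : ℤ) ∣ k - i ∨ InList l k := by
  simp [InList]

theorem inList_coe_iff {n : ℕ} {l : List (Fin n)} (i : Fin n) (s : ℤ) :
    InList l (i + s * n) ↔ i ∈ l := by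
  constructor
  · rintro ⟨j, hj, h⟩
    have := i.2
    have := j.2
    rw [show (i + s * n - j : ℤ) = i - j + s * n by ring, Int.dvd_add_left (dvd_mul_left _ _),
      dvd_iff_eq_zero (by omega) (by omega)] at h
    rwa [show i = j from Fin.ext (by omega)]
  · intro h
    exact ⟨i, h, s, by ring⟩

theorem inList_add_mul {n : ℕ} {l : List (Fin n)} (k s : ℤ) :
    InList l (k + s * n) ↔ InList l k := by
  unfold InList
  simp only [show ∀ i : ℤ, k + s * n - i = k - i + s * n by intro i; ring]
  simp only [Int.dvd_add_left (dvd_mul_left (n : ℤ) s)]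

theorem not_inList_of_dvd {n : ℕ} {i : Fin n} {l : List (Fin n)} {k : ℤ} (hi : i ∉ l)
    (hk : (n : ℤ) ∣ k - i) : ¬ InList l k := by
  obtain ⟨s, hs⟩ := hk
  rwa [show k = i + s * n by linarith, inList_coe_iff]

theorem not_inList_succ_of_dvd {n : ℕ} [NeZero n] {i : Fin n} {l : List (Fin n)} {k : ℤ}
    (hi : i + 1 ∉ l) (hk : (n : ℤ) ∣ k - i) : ¬ InList l (k + 1) := by
  refine not_inList_of_dvd hi ?_
  have hs := fin_val_succ i
  obtain ⟨s, hs'⟩ := hk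
  split_ifs at hs with h
  · refine ⟨s + 1, ?_⟩
    rw [hs, show k = i + n * s by linarith, show (i : ℤ) = n - 1 by omega]
    ring
  · exact ⟨s, by rw [hs, ← hs']; ring⟩

theorem affineWord_cons {n : ℕ} (i : Fin n) (l : List (Fin n)) (k : ℤ) :
    affineWord (i :: l) k = affineSwap n i (affineWord l k) := rfl

theorem affineWord_surjective {n : ℕ} (l : List (Fin n)) (hl : ∀ i ∈ l, 2 ≤ n) :
    Function.Surjective (affineWord l) := by
  induction l with
  | nil => exact Function.surjective_id
  | cons i l ih =>
    exact (affineSwap_involutive (hl i (by simp)) i).surjective.comp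
      (ih fun j hj => hl j (by simp [hj]))

theorem affineSwap_eq_self {n : ℕ} {i k : ℤ} (h1 : ¬ (n : ℤ) ∣ k - i) (h2 : ¬ (n : ℤ) ∣ k - 1 - i) :
    affineSwap n i k = k := by
  unfold affineSwap
  rw [if_neg h1, if_neg (by rwa [show k - i - 1 = k - 1 - i by ring])]

theorem affineWord_eq_self {n : ℕ} {l : List (Fin n)} {k : ℤ} (h1 : ¬ InList l k)
    (h2 : ¬ InList l (k - 1)) : affineWord l k = k := by
  induction l with
  | nil => rfl
  | cons i l ih =>
    rw [inList_cons, not_or] at h1 h2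
    rw [affineWord_cons, ih h1.2 h2.2, affineSwap_eq_self h1.1 h2.1]

/-- Letters act from right to left, and `i` acts before its successor. If `i` is the residue of `k`,
the letters before its turn fix `k + 1`, then `s_i` lowers it to `k`, and the letter `i - 1` that
could lower it further has already had its turn. -/
theorem affineWord_succ_of_inList {n : ℕ} [NeZero n] {l : List (Fin n)} (hl : ∀ i ∈ l, 2 ≤ n)
    (hnd : l.Nodup) (hp : l.Pairwise fun a b => b ≠ a + 1) {k : ℤ} (hk : InList l k) :
    affineWord l (k + 1) = k := by
  induction l with
  | nil => simp [InList] at hk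
  | cons i l ih =>
    rw [List.nodup_cons] at hnd
    rw [List.pairwise_cons] at hp
    have hn := hl i (by simp)
    have hi : i + 1 ∉ l := fun h => hp.1 _ h rfl
    rw [affineWord_cons]
    by_cases h : (n : ℤ) ∣ k - i
    · have h1 := not_inList_of_dvd hnd.1 h
      have h2 := not_inList_succ_of_dvd hi h
      rw [affineWord_eq_self h2 (by rwa [add_sub_cancel_right]), affineSwap, if_neg, if_pos]
      · ring
      · rwa [show k + 1 - i - 1 = k - i by ring]
      · rw [show k + 1 - i = k - i + 1 by ring]
        exact not_dvd_of_dvd_add_one hn h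
    · have hk' : InList l k := (inList_cons.1 hk).resolve_left h
      rw [ih (fun j hj => hl j (by simp [hj])) hnd.2 hp.2 hk', affineSwap_eq_self h]
      intro h'
      have := not_inList_succ_of_dvd hi h'
      rw [sub_add_cancel] at this
      exact this hk'

/-- The letter that would lower `k + 1` is absent. Since each letter acts before its successor, `k +
1` is carried up through the whole run of residues in the list, to the first integer outside it. -/
theorem affineWord_succ_of_not_inList {n : ℕ} [NeZero n] {l : List (Fin n)} (hl : ∀ i ∈ l, 2 ≤ n)
    (hnd : l.Nodup) (hp : l.Pairwise fun a b => b ≠ a + 1) {k : ℤ} (hk : ¬ InList l k) (r : ℕ)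
    (hr : ∀ s : ℕ, s < r → InList l (k + 1 + s)) (hr' : ¬ InList l (k + 1 + r)) :
    affineWord l (k + 1) = k + 1 + r := by
  induction l generalizing r with
  | nil =>
    rcases Nat.eq_zero_or_pos r with rfl | h
    · simp [affineWord]
    · have := hr 0 h
      simp [InList] at this
  | cons i l ih =>
    rw [List.nodup_cons] at hnd
    rw [List.pairwise_cons] at hp
    have hn := hl i (by simp)
    have hi : i + 1 ∉ l := fun h => hp.1 _ h rfl
    rw [affineWord_cons]
    simp only [inList_cons, not_or] at hk hr hr'
    by_cases h : ∃ s : ℕ, s < r ∧ (n : ℤ) ∣ k + 1 + s - i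
    · obtain ⟨s, hs, hsi⟩ := h
      -- The leftmost letter acts last. Its successor does not occur in the rest of the word, so it
      -- can only be the end of the run.
      have hsr : s + 1 = r := by
        by_contra hne
        have h2 := not_inList_succ_of_dvd hi hsi
        have h3 := hr (s + 1) (by omega)
        push_cast at h3
        rw [← add_assoc] at h3
        refine not_dvd_of_dvd_add_one hn hsi ?_
        have := h3.resolve_right h2
        rwa [show k + 1 + s - i + 1 = k + 1 + s + 1 - i by ring]
      subst hsr
      have : affineWord l (k + 1) = k + 1 + s := by
        refine ih (fun j hj => hl j (by simp [hj])) hnd.2 hp.2 hk.2 s (fun s' hs' => ?_)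
          (not_inList_of_dvd hnd.1 hsi)
        -- A second occurrence of the residue `i` in the run would be followed by a residue in `l`;
        -- a shift by a multiple of `n` then puts `k + 1 + r` in `l`.
        refine (hr s' (by omega)).resolve_left fun h' => ?_
        have h1 : (n : ℤ) ∣ (s : ℤ) - s' := by
          have := dvd_sub hsi h'
          rwa [show (k + 1 + s - i - (k + 1 + s' - i) : ℤ) = s - s' by ring] at this
        have h2 := hr (s' + 1) (by omega)
        obtain ⟨a, ha⟩ := h1
        refine hr'.2 ?_
        have h3 : ¬ (n : ℤ) ∣ k + 1 + (s' + 1 : ℕ) - i := by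
          have := not_dvd_of_dvd_add_one hn h'
          push_cast
          rwa [show (k + 1 + (s' + 1) - i : ℤ) = k + 1 + s' - i + 1 by ring]
        have h4 := h2.resolve_left h3
        rw [← inList_add_mul _ a] at h4
        convert h4 using 1
        push_cast
        linarith
      rw [this, affineSwap, if_pos hsi]
      push_cast
      ring
    · push Not at h
      have h1 : ∀ s : ℕ, s < r → InList l (k + 1 + s) := fun s hs => (hr s hs).resolve_left (h s hs)
      rw [ih (fun j hj => hl j (by simp [hj])) hnd.2 hp.2 hk.2 r h1 hr'.2]
      refine affineSwap_eq_self hr'.1 ?_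
      rcases Nat.eq_zero_or_pos r with rfl | hr0
      · simpa using hk.1
      · obtain ⟨r', rfl⟩ := Nat.exists_eq_succ_of_ne_zero hr0.ne'
        have := h r' (by omega)
        push_cast
        rwa [show (k + 1 + (r' + 1) - 1 - i : ℤ) = k + 1 + r' - i by ring]

theorem exists_first_not_inList {n : ℕ} [NeZero n] {l : List (Fin n)} (k : ℤ) (hk : ¬ InList l k) :
    ∃ r : ℕ, (∀ s : ℕ, s < r → InList l (k + 1 + s)) ∧ ¬ InList l (k + 1 + r) := by
  classical
  have hn : 0 < n := Nat.pos_of_ne_zero (NeZero.ne n)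
  have h : ∃ r : ℕ, ¬ InList l (k + 1 + r) := by
    refine ⟨n - 1, ?_⟩
    rwa [show k + 1 + ((n - 1 : ℕ) : ℤ) = k + 1 * n by push_cast [hn]; ring, inList_add_mul]
  exact ⟨Nat.find h, fun s hs => not_not.1 (Nat.find_min h hs), Nat.find_spec h⟩

theorem two_le_of_ne_univ {n : ℕ} {I : Finset (Fin n)} (hI : I ≠ Finset.univ) {i : Fin n} (hi : i ∈ I) :
    2 ≤ n := by
  by_contra h
  have := i.2
  obtain rfl : n = 1 := by omega
  refine hI (Finset.eq_univ_iff_forall.2 fun j => ?_)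
  rwa [Subsingleton.elim j i]

theorem mk_mul_scalar {n : ℕ} (u : (LaurentSeries ℂ)ˣ) (g : GL (Fin n) (LaurentSeries ℂ)) :
    (Matrix.ProjGenLinGroup.mk (Matrix.GeneralLinearGroup.scalar (Fin n) u * g) :
      PGL(n, LaurentSeries ℂ)) = Matrix.ProjGenLinGroup.mk g := by
  rw [map_mul, Matrix.ProjGenLinGroup.mk_scalar, one_mul]

theorem scalar_mul_mulVec {n : ℕ} (u : (LaurentSeries ℂ)ˣ) (g : GL (Fin n) (LaurentSeries ℂ))
    (v : Fin n → LaurentSeries ℂ) :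
    (Matrix.GeneralLinearGroup.scalar (Fin n) u * g).1.mulVec v = (u : LaurentSeries ℂ) • g.1.mulVec v := by
  rw [Units.val_mul, Matrix.GeneralLinearGroup.coe_scalar, ← Matrix.mulVec_mulVec]
  funext j
  simp [Matrix.mulVec_diagonal, Matrix.scalar_apply]

/-- `j` is the first element outside of `I` in the cyclic order starting at `m`. -/
def IsFirstOutside {n : ℕ} (I : Finset (Fin n)) (m j : Fin n) : Prop :=
  j ∉ I ∧ ∀ i, CycLE m i j → i ≠ j → i ∈ I

theorem cycLE_iff_topIdx {n : ℕ} {m i j : Fin n} : CycLE m i j ↔ topIdx m i ≤ topIdx m j := by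
  have := i.2
  have := j.2
  unfold CycLE topIdx
  simp only [Fin.le_def, Fin.lt_def]
  split_ifs <;> omega

theorem topIdx_injective {n : ℕ} (m : Fin n) : Function.Injective (topIdx m) := by
  intro i j h
  have := i.2
  have := j.2
  unfold topIdx at h
  refine Fin.ext ?_
  split_ifs at h <;> omega

theorem exists_isFirstOutside {n : ℕ} {I : Finset (Fin n)} (hI : I ≠ Finset.univ) (m : Fin n) :
    ∃ j, IsFirstOutside I m j := by
  have hne : (Finset.univ \ I).Nonempty := by
    rw [Finset.sdiff_nonempty]
    exact fun h => hI (Finset.univ_subset_iff.1 h)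
  obtain ⟨j, hj, hmin⟩ := Finset.exists_min_image _ (topIdx m) hne
  refine ⟨j, (Finset.mem_sdiff.1 hj).2, fun i hi hij => ?_⟩
  by_contra hiI
  refine hij (topIdx_injective m (le_antisymm (cycLE_iff_topIdx.1 hi) (hmin i ?_)))
  exact Finset.mem_sdiff.2 ⟨Finset.mem_univ _, hiI⟩

/-- The element `w_I` has a representative that carries each standard lattice `λ_m` to the preimage of a
coordinate line. -/
theorem exists_wElt_lift {n : ℕ} [NeZero n] (I : Finset (Fin n)) (hI : I ≠ Finset.univ) :
    ∃ g : GL (Fin n) (LaurentSeries ℂ), Matrix.ProjGenLinGroup.mk g = wRep n (wElt I hI) ∧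
      ∀ m j : Fin n, IsFirstOutside I m j →
        translateLattice g (stdLattice n m) = lineLattice m (coordLine j) := by
  set l := (exists_isAcceptableOrder I hI).choose with hldef
  have hacc : IsAcceptableOrder I l := (exists_isAcceptableOrder I hI).choose_spec
  have hn : (0 : ℤ) < n := by exact_mod_cast Nat.pos_of_ne_zero (NeZero.ne n)
  have hl : ∀ i ∈ l, 2 ≤ n := fun i hi => two_le_of_ne_univ hI ((hacc.2.1 i).1 hi)
  have hmon : IsMonomial (wRep n (wElt I hI)) (affineWord l ∘ fun k => k + 1) := by
    have := (isMonomial_wordProd l hl).mul (isMonomial_omega n)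
    rwa [← map_mul] at this
  obtain ⟨g, hg, hgE⟩ := hmon
  set w : ℤ → ℤ := fun k => affineWord l (k + 1) with hw
  have hsurj : ∀ k, ∃ k', w k' = k := by
    intro k
    obtain ⟨k', hk'⟩ := affineWord_surjective l hl k
    exact ⟨k' - 1, by rw [hw]; simp only [sub_add_cancel, hk']⟩
  have hin : ∀ k, InList l k → w k = k := fun k hk => affineWord_succ_of_inList hl hacc.1 hacc.pairwise hk
  have hout : ∀ k, ¬ InList l k → k < w k ∧ ¬ InList l (w k) ∧ ∀ k', k < k' → k' < w k → InList l k' := by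
    intro k hk
    obtain ⟨r, hr, hr'⟩ := exists_first_not_inList k hk
    have e : w k = k + 1 + r := affineWord_succ_of_not_inList hl hacc.1 hacc.pairwise hk r hr hr'
    rw [e]
    refine ⟨by omega, hr', fun k' h1 h2 => ?_⟩
    have := hr (k' - (k + 1)).toNat (by omega)
    rwa [Int.toNat_of_nonneg (by omega), add_sub_cancel] at this
  -- Since `w k ≥ k`, the monomial matrix `g` may push lattices upward. The scalar `t`, invisible in
  -- `PGL_n`, lowers all indices by `n` and places the image of `λ_m` between `t λ_m` and `λ_m`.
  refine ⟨Matrix.GeneralLinearGroup.scalar (Fin n) tUnit * g, by rw [mk_mul_scalar, hg], fun m j hj => ?_⟩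
  have hgE' : ∀ k, (Matrix.GeneralLinearGroup.scalar (Fin n) tUnit * g).1.mulVec (periodicVec n k) =
      periodicVec n (w k - n) := by
    intro k
    rw [scalar_mul_mulVec, hgE, show w k - n = w k + (-1) * n by ring, periodicVec_add_mul]
    simp [hw]
  have hb := topIdx_bounds m j
  have hmem : ∀ i, InList l (topIdx m i) ↔ i ∈ I := by
    intro i
    rw [← hacc.2.1 i]
    unfold topIdx
    split_ifs
    · have := inList_coe_iff (l := l) i 1
      rwa [one_mul] at this
    · have := inList_coe_iff (l := l) i 0
      rwa [zero_mul] at this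
  have hJ : ¬ InList l (topIdx m j) := fun h => hj.1 ((hmem j).1 h)
  have hJ1 : ∀ k, (m : ℤ) ≤ k → k < topIdx m j → InList l k := by
    intro k hk1 hk2
    obtain ⟨i, s, rfl⟩ := exists_topIdx m k
    have hi := topIdx_bounds m i
    have hs : s = 0 := by
      rcases lt_trichotomy s 0 with h | h | h
      · nlinarith
      · exact h
      · nlinarith
    subst hs
    rw [zero_mul, sub_zero] at hk2 ⊢
    exact (hmem i).2 (hj.2 i (cycLE_iff_topIdx.2 hk2.le) (fun h => by rw [h] at hk2; exact lt_irrefl _ hk2))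
  have hJn : ¬ InList l (topIdx m j + n) := by
    have := inList_add_mul (l := l) (topIdx m j) 1
    rw [one_mul] at this
    rwa [this]
  have hJ1n : ∀ k, (m : ℤ) + n ≤ k → k < topIdx m j + n → InList l k := by
    intro k hk1 hk2
    have := inList_add_mul (l := l) (k - n) 1
    rw [one_mul, sub_add_cancel] at this
    rw [this]
    exact hJ1 _ (by omega) (by omega)
  rw [stdLattice_eq_span, lineLattice_coordLine, translateLattice, Submodule.map_span]
  congr 1
  ext y
  constructor
  · rintro ⟨_, ⟨k, hk, rfl⟩, rfl⟩
    refine ⟨w k - n, ?_, (hgE' k).symm⟩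
    change k < m + n at hk
    by_cases hkI : InList l k
    · left
      rw [hin k hkI]
      omega
    · obtain ⟨h1, h2, h3⟩ := hout k hkI
      by_cases hlt : w k < m + n
      · left; omega
      · right
        -- Here `k < m + n ≤ w k`, and `w k` is the next integer outside `I`. It is therefore the
        -- first one from `m + n` on, namely `topIdx m j + n`.
        have h4 : w k ≤ topIdx m j + n := by
          by_contra h
          exact hJn (h3 _ (by omega) (by omega))
        have h5 : topIdx m j + n ≤ w k := by
          by_contra h
          exact h2 (hJ1n _ (by omega) (by omega))
        omega
  · rintro ⟨k, hk, rfl⟩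
    obtain ⟨k0, hk0⟩ := hsurj (k + n)
    have hle : k0 ≤ w k0 := by
      by_cases h : InList l k0
      · exact (hin _ h).ge
      · exact (hout _ h).1.le
    refine ⟨_, ⟨k0, ?_, rfl⟩, ?_⟩
    · change k0 < m + n
      rcases hk with hk | rfl
      · omega
      · by_contra h
        have h1 : ¬ InList l k0 := by
          intro h'
          rw [hin _ h'] at hk0
          exact hJn (hk0 ▸ h')
        have := (hout k0 h1).1
        exact h1 (hJ1n k0 (by omega) (by omega))
    · refine (hgE' k0).trans ?_
      rw [hk0, add_sub_cancel_right]

/-! ### The strata of the chart -/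

/-- In the cyclic order the interval runs from `k` to just before `j`. The exceptional value 1 of
`pFun` is the empty product at `j = k`. -/
theorem uVec_eq_prod {n : ℕ} [NeZero n] (k j : Fin n) (x : Fin n → ℂ) :
    uVec k x j = ∏ i ∈ Finset.univ.filter (fun i => CycLE k i j ∧ i ≠ j), x i := by
  by_cases h : j = k
  · subst h
    rw [uVec_self, Finset.filter_false_of_mem, Finset.prod_empty]
    intro i _
    simp only [CycLE, Fin.le_def, Fin.lt_def, ne_eq, Fin.ext_iff]
    omega
  · have h' : (j : ℕ) ≠ k := fun e => h (Fin.ext e)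
    have hp := fin_val_sub_one j
    have hj := j.2
    have hk := k.2
    unfold uVec
    rw [pFun_eq, if_neg (by split_ifs at hp <;> omega)]
    refine Finset.prod_congr ?_ fun _ _ => rfl
    ext i
    have hi := i.2
    simp only [Finset.mem_filter, Finset.mem_univ, true_and, CycLE, Fin.le_def, Fin.lt_def, ne_eq,
      Fin.ext_iff]
    split_ifs at hp <;> omega

theorem uVec_mul_uVec {n : ℕ} [NeZero n] {m r j : Fin n} (h : CycLE m r j) (x : Fin n → ℂ) :
    uVec m x r * uVec r x j = uVec m x j := by
  rw [uVec_eq_prod, uVec_eq_prod, uVec_eq_prod, ← Finset.prod_union]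
  · refine Finset.prod_congr ?_ fun _ _ => rfl
    ext i
    simp only [Finset.mem_union, Finset.mem_filter, Finset.mem_univ, true_and, CycLE, Fin.le_def,
      Fin.lt_def, ne_eq, Fin.ext_iff] at h ⊢
    omega
  · rw [Finset.disjoint_left]
    intro i
    simp only [Finset.mem_filter, Finset.mem_univ, true_and, CycLE, Fin.le_def,
      Fin.lt_def, ne_eq, Fin.ext_iff] at h ⊢
    omega

theorem uVec_eq_zero {n : ℕ} [NeZero n] {m r j : Fin n} (h : ¬ CycLE m r j) {x : Fin n → ℂ}
    (hx : x j = 0) : uVec m x r = 0 := by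
  rw [uVec_eq_prod]
  refine Finset.prod_eq_zero (i := j) ?_ hx
  simp only [Finset.mem_filter, Finset.mem_univ, true_and, CycLE, Fin.le_def,
    Fin.lt_def, ne_eq, Fin.ext_iff] at h ⊢
  omega

theorem uVec_ne_zero_of_isFirstOutside {n : ℕ} [NeZero n] {I : Finset (Fin n)} {m j : Fin n}
    (hj : IsFirstOutside I m j) {x : AffSpace n} (hx : x ∈ AffSpace.stratum I) :
    uVec m x.coord j ≠ 0 := by
  rw [uVec_eq_prod, Finset.prod_ne_zero_iff]
  intro i hi
  obtain ⟨h1, h2⟩ := (Finset.mem_filter.1 hi).2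
  exact fun h0 => (hx i).1 h0 (hj.2 i h1 h2)

/-- If `r` lies between `m` and `j`, the interval from `m` to `j` splits at `r` and `1 / (u_r)_j =
(u_m)_r / (u_m)_j`. If `r` lies beyond `j`, then `(u_m)_r` contains the factor `x_j = 0`. Entries of
the matrix that are inverses of 0 are not met here. -/
theorem cycUpper_mulVec_single {n : ℕ} [NeZero n] {I : Finset (Fin n)} {m j : Fin n}
    (hj : IsFirstOutside I m j) {x : AffSpace n} (hx : x ∈ AffSpace.stratum I) :
    (cycUpper (Matrix.of fun r c => (uVec r x.coord c)⁻¹) m).mulVec (Pi.single j 1) =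
      (uVec m x.coord j)⁻¹ • uVec m x.coord := by
  funext r
  rw [Matrix.mulVec_single_one]
  simp only [Matrix.col_apply, cycUpper, Matrix.of_apply, Pi.smul_apply, smul_eq_mul]
  by_cases h : CycLE m r j
  · have h1 := uVec_mul_uVec h x.coord
    have h2 := uVec_ne_zero_of_isFirstOutside hj hx
    rw [← h1] at h2 ⊢
    have h3 := left_ne_zero_of_mul h2
    have h4 := right_ne_zero_of_mul h2
    rw [if_pos h]
    field_simp
  · rw [if_neg h, uVec_eq_zero h ((hx j).2 hj.1), mul_zero]

theorem chart_mem_special_of_mem_stratum {n : ℕ} [NeZero n] {I : Finset (Fin n)}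
    (hI : I ≠ Finset.univ) {x : AffSpace n} (hx : x ∈ AffSpace.stratum I) :
    chart n x ∈ GrBar.special n := by
  obtain ⟨j, hj⟩ := exists_isFirstOutside hI 0
  exact Finset.prod_eq_zero (Finset.mem_univ j) ((hx j).2 hj.1)

/-- A single Iwahori element, built from the `1 / (u_r)_c`, carries all the coordinate lines of the
point `w_I` to the lines of `u(x)` simultaneously. Its diagonal entries are 1. -/
theorem chart_mem_flStratum {n : ℕ} [NeZero n] {I : Finset (Fin n)}
    (hI : I ≠ Finset.univ) {x : AffSpace n} (hx : x ∈ AffSpace.stratum I) :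
    chart n x ∈ flStratum I hI := by
  refine ⟨chart_mem_special_of_mem_stratum hI hx, ?_⟩
  obtain ⟨g, hg, hg'⟩ := exists_wElt_lift I hI
  have hβ : ∀ i, (Matrix.of fun r c => (uVec r x.coord c)⁻¹ : Matrix (Fin n) (Fin n) ℂ) i i ≠ 0 := by
    intro i
    simp [uVec_self]
  rw [toFl_eq _ (g := Matrix.GeneralLinearGroup.map toLaurent (iwahoriElt _ hβ) * g)]
  · exact ⟨⟨_, mk_map_mem_iwahori (iwahoriElt_mem _ hβ)⟩, by rw [← hg]; rfl⟩
  · intro m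
    obtain ⟨j, hj⟩ := exists_isFirstOutside hI m
    rw [translateLattice_mul, hg' m j hj]
    refine translateLattice_iwahoriElt hβ m _ ?_
    rw [cycUpper_mulVec_single hj hx]
    exact mem_mk_submodule.2 ⟨_, rfl⟩

/-! ### Disjointness of the strata -/

theorem constantCoeff_diag_ne_zero {n : ℕ} {h : GL (Fin n) (PowerSeries ℂ)} (hh : h ∈ iwahoriGL n)
    (j : Fin n) : PowerSeries.constantCoeff (h.1 j j) ≠ 0 := by
  have h1 := Matrix.det_of_isUpperTriangular (M := h.1.map (PowerSeries.constantCoeff (R := ℂ))) hh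
  have h2 : IsUnit (h.1.map (PowerSeries.constantCoeff (R := ℂ))).det := by
    have := ((Matrix.isUnit_iff_isUnit_det _).1 h.isUnit).map (PowerSeries.constantCoeff (R := ℂ))
    rwa [RingHom.map_det] at this
  rw [h1, isUnit_iff_ne_zero, Finset.prod_ne_zero_iff] at h2
  exact h2 j (Finset.mem_univ j)

theorem scalar_mul_comm {n : ℕ} (u : (LaurentSeries ℂ)ˣ) (g : GL (Fin n) (LaurentSeries ℂ)) :
    Matrix.GeneralLinearGroup.scalar (Fin n) u * g = g * Matrix.GeneralLinearGroup.scalar (Fin n) u := by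
  have h : Matrix.GeneralLinearGroup.scalar (Fin n) u ∈ Subgroup.center (GL (Fin n) (LaurentSeries ℂ)) := by
    rw [Matrix.GeneralLinearGroup.center_eq_range_scalar]
    exact ⟨u, rfl⟩
  exact (Subgroup.mem_center_iff.1 h g).symm

/-- Choose `y ∈ λ_m` that `g` sends to the basis vector of `λ_m` in direction `j`, apply both sides
of `e` to it, and compare `j`-th coordinates in the basis of `λ_m`. The left side gives `u` times
the unit `h_{jj}`. The right side lies in the preimage of the line of `j'`, so its coordinate is
integral, and divisible by `t` when `j ≠ j'`. -/
theorem exists_scalar_lift {n : ℕ} [NeZero n] {h h' : GL (Fin n) (PowerSeries ℂ)}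
    (hh : h ∈ iwahoriGL n) (hh' : h' ∈ iwahoriGL n) {g g' : GL (Fin n) (LaurentSeries ℂ)}
    {u : (LaurentSeries ℂ)ˣ} {m j j' : Fin n}
    (hg : translateLattice g (stdLattice n m) = lineLattice m (coordLine j))
    (hg' : translateLattice g' (stdLattice n m) = lineLattice m (coordLine j'))
    (e : Matrix.GeneralLinearGroup.scalar (Fin n) u * (Matrix.GeneralLinearGroup.map toLaurent h * g) =
      g' * Matrix.GeneralLinearGroup.map toLaurent h') :
    ∃ a : PowerSeries ℂ, toLaurent a = u ∧ (j ≠ j' → PowerSeries.constantCoeff a = 0) := by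
  have hmem : latticeCoord n m (Pi.single j 1) ∈ lineLattice m (coordLine j) := by
    refine ⟨_, ?_, rfl⟩
    rw [SetLike.mem_coe, mem_reducesTo, mem_mk_submodule]
    refine ⟨1, funext fun i => ?_⟩
    by_cases hi : i = j
    · subst hi; simp
    · simp [hi]
  rw [← hg] at hmem
  obtain ⟨y, hy, hy'⟩ := mem_translateLattice.1 hmem
  obtain ⟨B, hB, hB'⟩ := exists_mulVec_latticeCoord m (mem_iwahoriGL.1 hh)
  have h1 : (u : LaurentSeries ℂ) • latticeCoord n m (B.mulVec (Pi.single j 1)) ∈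
      lineLattice m (coordLine j') := by
    rw [← hg', mem_translateLattice]
    refine ⟨_, mulVec_mem_stdLattice hh' m hy, ?_⟩
    rw [Matrix.mulVec_mulVec, ← Units.val_mul, ← e, scalar_mul_mulVec, Units.val_mul,
      ← Matrix.mulVec_mulVec, hy', ← hB']
    rfl
  obtain ⟨c, hc, hc'⟩ := h1
  have h2 := congrFun hc' j
  rw [Pi.smul_apply, latticeCoord_eq, latticeCoord_eq, Matrix.mulVec_single_one, Matrix.col_apply, hB,
    smul_eq_mul, mul_left_comm] at h2
  have h3 := (latticeScale (m : ℕ) j).isUnit.mul_left_cancel h2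
  have hd := constantCoeff_diag_ne_zero hh j
  obtain ⟨d, hd'⟩ : IsUnit (h.1 j j) := by
    rw [PowerSeries.isUnit_iff_constantCoeff]
    exact hd.isUnit
  refine ⟨c j * ((d⁻¹ : (PowerSeries ℂ)ˣ) : PowerSeries ℂ), ?_, fun hne => ?_⟩
  · rw [map_mul, h3, ← hd', mul_assoc, ← map_mul, Units.mul_inv, map_one, mul_one]
  · obtain ⟨s, hs⟩ := mem_mk_submodule.1 (mem_reducesTo.1 hc)
    have := congrFun hs j
    rw [Pi.smul_apply, Pi.single_eq_of_ne hne, smul_zero] at this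
    rw [map_mul, ← this, zero_mul]

/-- Equality in `PGL_n` leaves a scalar `u` undetermined. The preceding lemma, applied to the
equation and to its inverse, shows `u` and `u⁻¹` integral; `j ≠ j'` would make `u` divisible by `t`.
-/
theorem firstOutside_eq {n : ℕ} [NeZero n] {h h' : GL (Fin n) (PowerSeries ℂ)}
    (hh : h ∈ iwahoriGL n) (hh' : h' ∈ iwahoriGL n) {g g' : GL (Fin n) (LaurentSeries ℂ)}
    {u : (LaurentSeries ℂ)ˣ} {m j j' : Fin n}
    (hg : translateLattice g (stdLattice n m) = lineLattice m (coordLine j))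
    (hg' : translateLattice g' (stdLattice n m) = lineLattice m (coordLine j'))
    (e : Matrix.GeneralLinearGroup.scalar (Fin n) u * (Matrix.GeneralLinearGroup.map toLaurent h * g) =
      g' * Matrix.GeneralLinearGroup.map toLaurent h') : j = j' := by
  obtain ⟨a, ha, ha'⟩ := exists_scalar_lift hh hh' hg hg' e
  obtain ⟨b, hb, -⟩ := exists_scalar_lift (u := u⁻¹) (inv_mem hh) (inv_mem hh') hg' hg (by
    rw [map_inv, map_inv, map_inv, inv_mul_eq_iff_eq_mul, inv_mul_eq_iff_eq_mul, ← mul_assoc, ← mul_assoc,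
      eq_mul_inv_iff_mul_eq, ← e, scalar_mul_comm u, mul_assoc, mul_assoc, scalar_mul_comm u g])
  by_contra hne
  have h1 : a * b = 1 := toLaurent_injective (by rw [map_mul, ha, hb, map_one, Units.mul_inv])
  have h2 := congrArg PowerSeries.constantCoeff h1
  rw [map_mul, ha' hne, zero_mul, map_one] at h2
  exact zero_ne_one h2

theorem isFirstOutside_self {n : ℕ} {I : Finset (Fin n)} {m : Fin n} (hm : m ∉ I) :
    IsFirstOutside I m m := by
  refine ⟨hm, fun i hi him => absurd (Fin.ext ?_) him⟩
  simp only [CycLE, Fin.le_def, Fin.lt_def] at hi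
  omega

theorem eq_of_mem_flOrbit {n : ℕ} [NeZero n] {I J : Finset (Fin n)} (hI : I ≠ Finset.univ)
    (hJ : J ≠ Finset.univ) {p : Fl n} (hpI : p ∈ flOrbit (wElt I hI)) (hpJ : p ∈ flOrbit (wElt J hJ)) :
    I = J := by
  obtain ⟨g, hg, hgI⟩ := exists_wElt_lift I hI
  obtain ⟨g', hg', hgJ⟩ := exists_wElt_lift J hJ
  unfold flOrbit at hpI hpJ
  rw [← hg] at hpI
  rw [← hg'] at hpJ
  have hmem := MulAction.mem_orbit_self (M := iwahori n)
    (QuotientGroup.mk (Matrix.ProjGenLinGroup.mk g') : Fl n)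
  rw [← MulAction.orbit_eq_iff.2 hpJ, MulAction.orbit_eq_iff.2 hpI] at hmem
  obtain ⟨⟨b, hb⟩, hbg⟩ := hmem
  obtain ⟨h, hh, rfl⟩ := mem_iwahori.1 hb
  obtain ⟨h', hh', hbg'⟩ := mem_iwahori.1 (QuotientGroup.eq.1 hbg.symm)
  rw [eq_inv_mul_iff_mul_eq, ← map_mul] at hbg'
  have e0 : Matrix.ProjGenLinGroup.mk (Matrix.GeneralLinearGroup.map toLaurent h * g) =
      Matrix.ProjGenLinGroup.mk (g' * Matrix.GeneralLinearGroup.map toLaurent h') :=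
    (map_mul _ _ _).trans hbg'.symm
  obtain ⟨u, hu⟩ := Matrix.ProjGenLinGroup.mk_eq_mk_iff.1 e0
  rw [← scalar_mul_comm] at hu
  ext m
  obtain ⟨j, hj⟩ := exists_isFirstOutside hI m
  obtain ⟨j', hj'⟩ := exists_isFirstOutside hJ m
  constructor
  · intro hmI
    by_contra hmJ
    have := firstOutside_eq hh hh' (hgI m j hj) (hgJ m m (isFirstOutside_self hmJ)) hu
    exact hj.1 (this ▸ hmI)
  · intro hmJ
    by_contra hmI
    have := firstOutside_eq hh hh' (hgI m m (isFirstOutside_self hmI)) (hgJ m j' hj') hu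
    exact hj'.1 (this ▸ hmJ)

/-- A point `x` over the special fiber lies in the stratum of its own support `J`, so `u(x)` lies in
`Fl_J`; disjointness of the orbits then gives `J = I`. -/
theorem preimage_flStratum {n : ℕ} [NeZero n] (I : Finset (Fin n)) (hI : I ≠ Finset.univ) :
    chart n ⁻¹' flStratum I hI = AffSpace.stratum I := by
  refine Set.Subset.antisymm ?_ fun x hx => chart_mem_flStratum hI hx
  rintro x ⟨hs, hx⟩
  classical
  let J : Finset (Fin n) := Finset.univ.filter fun i => x.coord i ≠ 0
  have hxJ : x ∈ AffSpace.stratum J := fun i => by simp [J]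
  have hJ : J ≠ Finset.univ := by
    obtain ⟨i, -, hi⟩ := Finset.prod_eq_zero_iff.1 (show ∏ i, x.coord i = 0 from hs)
    exact fun h => (hxJ i).1 hi (h ▸ Finset.mem_univ i)
  obtain ⟨_, hx'⟩ := chart_mem_flStratum hJ hxJ
  obtain rfl := eq_of_mem_flOrbit hI hJ hx hx'
  exact hxJ

/-! ### The chart meets every orbit -/

/-- The orders starting at `i` and `i + 1` differ only in moving `i` from first to last place. As
first element its column in `cycUpper β i` is diagonal, as last its row in `cycUpper β (i + 1)` is,
and `g_i(0)` kills that diagonal entry. This keeps the moved lines inside `X`. -/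
theorem gMat_mul_cycUpper {n : ℕ} [NeZero n] (β : Matrix (Fin n) (Fin n) ℂ) (i : Fin n) :
    gMat n i 0 * cycUpper β i = cycUpper β (i + 1) * gMat n i 0 := by
  ext r c
  unfold gMat
  rw [Matrix.diagonal_mul, Matrix.mul_diagonal]
  have hs := fin_val_succ i
  have hi := i.2
  have hr := r.2
  have hc := c.2
  simp only [cycUpper, Matrix.of_apply, CycLE, Fin.le_def, Fin.lt_def, Fin.ext_iff]
  split_ifs at hs ⊢ <;> first | omega | simp

/-- The first condition makes the Iwahori matrix invertible, the second makes the `m`-th coordinate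
of the moved line nonzero. -/
theorem exists_row {n : ℕ} (m : Fin n) {v : Fin n → ℂ} (hv : v ≠ 0) :
    ∃ b : Fin n → ℂ, b m ≠ 0 ∧ ∑ c, b c * v c ≠ 0 := by
  by_cases hm : v m = 0
  · obtain ⟨c, hc⟩ := Function.ne_iff.1 hv
    have hmc : m ≠ c := fun h => hc (h ▸ hm)
    refine ⟨Pi.single m 1 + Pi.single c 1, by simp [hmc], ?_⟩
    simpa [add_mul, Finset.sum_add_distrib, Pi.single_apply, hm] using hc
  · exact ⟨Pi.single m 1, by simp, by simpa [Pi.single_apply] using hm⟩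

theorem exists_chart_mem_orbit {n : ℕ} [NeZero n] (q : GrBar.special n) :
    ∃ (x : AffSpace n) (hx : chart n x ∈ GrBar.special n),
      toFl ⟨chart n x, hx⟩ ∈ MulAction.orbit (iwahori n) (toFl q) := by
  choose b hb hb' using fun m => exists_row m (q.1.L m).rep_nonzero
  let β : Matrix (Fin n) (Fin n) ℂ := Matrix.of b
  have hv : ∀ m, (cycUpper β m).mulVec (q.1.L m).rep m ≠ 0 := by
    intro m
    have : (cycUpper β m).mulVec (q.1.L m).rep m = ∑ c, b m c * (q.1.L m).rep c := by
      unfold Matrix.mulVec dotProduct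
      refine Finset.sum_congr rfl fun c _ => ?_
      simp only [cycUpper, Matrix.of_apply, β]
      -- The index `m` is least in the cyclic order starting at `m`, so `cycUpper β m` keeps the
      -- whole row `m` of `β`.
      rw [if_pos]
      simp only [CycLE, Fin.le_def, Fin.lt_def]
      omega
    rw [this]
    exact hb' m
  have hq0 : q.1.y = 0 := q.2
  let q' : GrBar n :=
    { y := 0
      L := fun m => Projectivization.mk ℂ ((cycUpper β m).mulVec (q.1.L m).rep)
        fun h => hv m (congrFun h m)
      incl := by
        intro i w hw
        obtain ⟨s, rfl⟩ := mem_mk_submodule.1 hw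
        obtain ⟨c, hc⟩ := mem_submodule_iff.1 (q.1.incl i _ (rep_mem_submodule _))
        rw [hq0] at hc
        refine mem_mk_submodule.2 ⟨s * c, ?_⟩
        rw [Matrix.mulVec_smul, Matrix.mulVec_mulVec, gMat_mul_cycUpper, ← Matrix.mulVec_mulVec, ← hc,
          Matrix.mulVec_smul, smul_smul] }
  have hdom : q' ∈ chartDomain n := by
    intro m
    obtain ⟨a, ha⟩ := Projectivization.exists_smul_eq_mk_rep ℂ
      ((cycUpper β m).mulVec (q.1.L m).rep) fun h => hv m (congrFun h m)
    rw [show (q'.L m).rep = _ from ha.symm]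
    exact mul_ne_zero a.ne_zero (hv m)
  have hsp : q' ∈ GrBar.special n := rfl
  have hx : chart n (chartInv q') = q' := chart_chartInv hdom
  refine ⟨chartInv q', hx.symm ▸ hsp, ?_⟩
  have e : (⟨chart n (chartInv q'), hx.symm ▸ hsp⟩ : GrBar.special n) = ⟨q', hsp⟩ := Subtype.ext hx
  rw [e, toFl_eq ⟨q', hsp⟩ (g := Matrix.GeneralLinearGroup.map toLaurent (iwahoriElt β hb) *
    (exists_latticeChain q.1 q.2).choose)]
  · exact ⟨⟨_, mk_map_mem_iwahori (iwahoriElt_mem β hb)⟩, rfl⟩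
  · intro m
    rw [translateLattice_mul, (exists_latticeChain q.1 q.2).choose_spec m]
    conv_lhs => rw [← (q.1.L m).mk_rep]
    exact translateLattice_iwahoriElt hb m _ (mem_mk_submodule.2 ⟨1, one_smul _ _⟩)

end GlobalSchubert

end

theorem mainTheorem9 (n : ℕ) [NeZero n] :
    (∀ (t : GlobalSchubert.HatT n) (x : GlobalSchubert.AffSpace n),
      GlobalSchubert.chart n (t • x) = t • GlobalSchubert.chart n x) ∧
    GlobalSchubert.IsVarietyOpenEmbedding GlobalSchubert.AffSpace.IsRegularOn
      GlobalSchubert.GrBar.IsRegularOn (GlobalSchubert.chart n) ∧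
    GlobalSchubert.chart n ⁻¹' GlobalSchubert.GrBar.generic n =
      GlobalSchubert.AffSpace.generic n ∧
    (∀ (I : Finset (Fin n)) (hI : I ≠ Finset.univ),
      GlobalSchubert.chart n ⁻¹' GlobalSchubert.flStratum I hI =
        GlobalSchubert.AffSpace.stratum I) ∧
    (∀ q : GlobalSchubert.GrBar.special n,
      ∃ (x : GlobalSchubert.AffSpace n)
        (hx : GlobalSchubert.chart n x ∈ GlobalSchubert.GrBar.special n),
        GlobalSchubert.toFl ⟨GlobalSchubert.chart n x, hx⟩ ∈
          MulAction.orbit (GlobalSchubert.iwahori n) (GlobalSchubert.toFl q)) := by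
  exact ⟨GlobalSchubert.chart_smul n, GlobalSchubert.isVarietyOpenEmbedding_chart n, rfl,
    GlobalSchubert.preimage_flStratum, GlobalSchubert.exists_chart_mem_orbit⟩
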